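/- All elliptic curves are given by Weierstrass equations $y^2+a_1xy+a_3y=x^3+a_2x^2+a_4x+a_6$ over $\mathbb{Q}$, with the usual invariants $c_4,c_6,\Delta$. Such an equation is \emph{(global) minimal} if its coefficients are integers and, for every prime $p$, $v_p(\Delta)$ is the least possible among all equations with $p$-integral coefficients obtained from it by a change of variables over $\mathbb{Q}$. Here $v_p$ is the $p$-adic valuation on $\mathbb{Q}$, with $v_p(0)=\infty$. For $u\in\mathbb{Q}^\times$ and $r,s,t\in\mathbb{Q}$, the change of variables $[u,r,s,t]$ is $x=u^2x'+r$, $y=u^3y'+u^2sx'+t$. Let $E$ be an elliptic curve over $\mathbb{Q}$ given by a minimal equation with coefficients $a_i$, and let $d$ be a square-free integer. Let $E^d$ be the quadratic twist of $E$ by $d$, given by Connell's equation $$y^2+a_1xy+a_3y=x^3+\Big(a_2d+a_1^2\tfrac{d-1}{4}\Big)x^2+\Big(a_4d^2+a_1a_3\tfrac{d^2-1}{2}\Big)x+\Big(a_6d^3+a_3^2\tfrac{d^3-1}{4}\Big).$$ For a prime $p$ put $\lambda_p=\min\{3v_p(c_4(E)),\,2v_p(c_6(E)),\,v_p(\Delta(E))\}$,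 and call $(v_p(c_4(E)),v_p(c_6(E)),v_p(\Delta(E)))$ the $p$-adic signature of $E$. Define $u_p$ as follows. 1. Let $p$ be odd. If $p\nmid d$, then $u_p=1$. If $p\mid d$, then: (a) if $\lambda_p<6$, or if $p=3$ and $v_3(c_6(E))=5$, then $u_p=1$; (b) otherwise $u_p=p$. 2. Let $p=2$. (a) If $d\equiv1\bmod 4$, then $u_2=1$. (b) If $d\equiv3\bmod4$, then: (i) if the $2$-adic signature of $E$ is $(0,0,c)$ with $c\ge0$, or $(a,3,0)$ with $4\le a\le\infty$, then $u_2=\tfrac12$; (ii) if the $2$-adic signature is $(4,6,c)$ with $c\ge12$ and $2^{-6}c_6(E)d\equiv-1\bmod4$, or $(a,9,12)$ with $8\le a\le\infty$ and $2^{-9}c_6(E)d\equiv1\bmod4$, then $u_2=2$; (iii) otherwise $u_2=1$. (c) If $d\equiv2\bmod4$, let $w=d/2$; then: (i) if the $2$-adic signature is $(0,0,c)$ with $c\ge0$, then $u_2=\tfrac12$; (ii) if the $2$-adic signature is $(6,9,c)$ with $c\ge18$ and $2^{-9}c_6(E)w\equiv-1\bmod4$, then $u_2=4$; (iii) if $v_2(c_4(E))\in\{4,5\}$,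 or $v_2(c_6(E))\in\{3,5,7\}$, or the $2$-adic signature is $(a,6,6)$ with $6\le a\le\infty$ and $2^{-6}c_6(E)w\equiv-1\bmod4$, then $u_2=1$; (iv) otherwise $u_2=2$. Let $\tilde u=\prod_pu_p$, the product over all primes $p$ (all but finitely many factors are $1$). Then there exist $r,s,t\in\mathbb{Q}$ such that the change of variables $[\tilde u,r,s,t]$ transforms the equation $E^d$ into a global minimal equation. -/

import Mathlib

namespace QuadraticTwist

/-- The `p`-adic valuations on `ℚ` are discrete: the ring `ℤ_(p)` of `p`-integral rationals is a
discrete valuation ring, with fraction field `ℚ`. -/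
instance padicValuationSubring_isDiscreteValuationRing (p : ℕ) [Fact p.Prime] :
    IsDiscreteValuationRing (Rat.padicValuation p).valuationSubring := by
  have : (Rat.padicValuation p).IsNontrivial := ⟨p, by simp, by
    rw [Rat.padicValuation_self]; decide⟩
  infer_instance

/-- A Weierstrass equation over `ℚ` is *global minimal* if its coefficients are integers and it is
a minimal Weierstrass equation at every prime `p`, i.e. among all the `p`-integral Weierstrass
equations related to it by a change of variables over `ℚ`, it has the least `v_p(Δ)`. -/
def IsGlobalMinimal (W : WeierstrassCurve ℚ) : Prop :=
  W.IsIntegral ℤ ∧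
    ∀ (p : ℕ) [Fact p.Prime], W.IsMinimal (Rat.padicValuation p).valuationSubring

/-- Connell's Weierstrass equation `E^d` for the quadratic twist of `E` by `d`. -/
def twist (E : WeierstrassCurve ℚ) (d : ℤ) : WeierstrassCurve ℚ where
  a₁ := E.a₁
  a₂ := E.a₂ * d + E.a₁ ^ 2 * ((d - 1) / 4)
  a₃ := E.a₃
  a₄ := E.a₄ * d ^ 2 + E.a₁ * E.a₃ * ((d ^ 2 - 1) / 2)
  a₆ := E.a₆ * d ^ 3 + E.a₃ ^ 2 * ((d ^ 3 - 1) / 4)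

/-- The standard `p`-adic valuation on `ℚ`, with `v_p(0) = ∞`. -/
def vp (p : ℕ) (x : ℚ) : WithTop ℤ :=
  if x = 0 then ⊤ else (padicValRat p x : ℤ)

/-- `λ_{v_p} = min {3 v_p(c₄), 2 v_p(c₆), v_p(Δ)}`. -/
def lam (E : WeierstrassCurve ℚ) (p : ℕ) : WithTop ℤ :=
  min (3 • vp p E.c₄) (min (2 • vp p E.c₆) (vp p E.Δ))

/-- The `p`-adic signature of `E` is `(a, b, c)`. -/
def HasSignature (E : WeierstrassCurve ℚ) (p : ℕ) (a b c : WithTop ℤ) : Prop :=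
  vp p E.c₄ = a ∧ vp p E.c₆ = b ∧ vp p E.Δ = c

open Classical in
/-- The local factor `u_p` at an odd prime `p`. -/
noncomputable def oddFactor (E : WeierstrassCurve ℚ) (d : ℤ) (p : ℕ) : ℚ :=
  if (p : ℤ) ∣ d then
    if lam E p < 6 ∨ (p = 3 ∧ vp p E.c₆ = 5) then 1 else p
  else 1

open Classical in
/-- The local factor `u_2` when `d ≡ 3 mod 4`. -/
noncomputable def twoFactorOfThreeModFour (E : WeierstrassCurve ℚ) (d : ℤ) : ℚ :=
  if (∃ c, 0 ≤ c ∧ HasSignature E 2 0 0 c) ∨ (∃ a, 4 ≤ a ∧ HasSignature E 2 a 3 0) then 1 / 2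
  else if
      (∃ c, 12 ≤ c ∧ HasSignature E 2 4 6 c ∧ E.c₆ / 2 ^ 6 * d ≡ -1 [PMOD (4 : ℚ)]) ∨
      (∃ a, 8 ≤ a ∧ HasSignature E 2 a 9 12 ∧ E.c₆ / 2 ^ 9 * d ≡ 1 [PMOD (4 : ℚ)]) then 2
  else 1

open Classical in
/-- The local factor `u_2` when `d ≡ 2 mod 4`; here `w = d / 2`. -/
noncomputable def twoFactorOfTwoModFour (E : WeierstrassCurve ℚ) (d : ℤ) : ℚ :=
  let w : ℚ := (d : ℚ) / 2
  if ∃ c, 0 ≤ c ∧ HasSignature E 2 0 0 c then 1 / 2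
  else if ∃ c, 18 ≤ c ∧ HasSignature E 2 6 9 c ∧ E.c₆ / 2 ^ 9 * w ≡ -1 [PMOD (4 : ℚ)] then 4
  else if (vp 2 E.c₄ = 4 ∨ vp 2 E.c₄ = 5) ∨
      (vp 2 E.c₆ = 3 ∨ vp 2 E.c₆ = 5 ∨ vp 2 E.c₆ = 7) ∨
      (∃ a, 6 ≤ a ∧ HasSignature E 2 a 6 6 ∧ E.c₆ / 2 ^ 6 * w ≡ -1 [PMOD (4 : ℚ)]) then 1
  else 2

open Classical in
/-- The local factor `u_p` at a prime `p`. (A square-free `d` is congruent to `1`, `2` or `3`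
modulo `4`, so the three cases for `p = 2` are exhaustive.) -/
noncomputable def localFactor (E : WeierstrassCurve ℚ) (d : ℤ) (p : ℕ) : ℚ :=
  if p = 2 then
    if d ≡ 1 [ZMOD 4] then 1
    else if d ≡ 3 [ZMOD 4] then twoFactorOfThreeModFour E d
    else twoFactorOfTwoModFour E d
  else oddFactor E d p

/-- All but finitely many of the local factors are `1`. -/
theorem finite_mulSupport_localFactor (E : WeierstrassCurve ℚ) {d : ℤ} (hd : d ≠ 0) :
    (Function.mulSupport fun p : Nat.Primes => localFactor E d p).Finite := by
  refine Set.Finite.of_finite_image (f := fun p : Nat.Primes => (p : ℕ))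
    ((Set.finite_Iic (2 + d.natAbs)).subset ?_) Subtype.val_injective.injOn
  rintro _ ⟨p, hp, rfl⟩
  by_contra hlt
  simp only [Set.mem_Iic, not_le] at hlt
  refine hp ?_
  have h2 : (p : ℕ) ≠ 2 := by omega
  have hnd : ¬ ((p : ℕ) : ℤ) ∣ d := fun h => by
    have := Nat.le_of_dvd (Int.natAbs_pos.mpr hd) (Int.natCast_dvd.mp h)
    omega
  simp [localFactor, oddFactor, h2, hnd]

/-- `ũ = ∏_p u_p`, the product over all primes `p`. -/
noncomputable def uTilde (E : WeierstrassCurve ℚ) (d : ℤ) : ℚ :=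
  ∏ᶠ p : Nat.Primes, localFactor E d p

end QuadraticTwist

namespace QuadraticTwist

/-- The condition at `2` in Kraus's criterion. -/
def KrausTwo (A B : ℤ) : Prop :=
  B % 4 = 3 ∨ (16 ∣ A ∧ (B % 32 = 0 ∨ B % 32 = 8))

/-- The condition at `3` in Kraus's criterion. -/
def KrausThree (B : ℤ) : Prop := 9 ∣ B → 27 ∣ B

/-- The condition at `p` in Kraus's criterion; it is empty for `p ≥ 5`. -/
def KrausAt (p : ℕ) (A B : ℤ) : Prop :=
  (p = 2 → KrausTwo A B) ∧ (p = 3 → KrausThree B)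

/-- `(A, B, D)` remains `p`-integral and satisfies Kraus's condition at `p` after it is divided by
the fourth, sixth and twelfth power of `p ^ k`. -/
def Admissible (p k : ℕ) (A B D : ℤ) : Prop :=
  ∃ a b c : ℤ, A = (p : ℤ) ^ (4 * k) * a ∧ B = (p : ℤ) ^ (6 * k) * b ∧
    D = (p : ℤ) ^ (12 * k) * c ∧ KrausAt p a b

theorem krausTwo_curve (V : WeierstrassCurve ℤ) : KrausTwo V.c₄ V.c₆ := by
  simp only [KrausTwo, WeierstrassCurve.c₄, WeierstrassCurve.c₆, WeierstrassCurve.b₂,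
    WeierstrassCurve.b₄, WeierstrassCurve.b₆]
  generalize V.a₁ = a₁, V.a₂ = a₂, V.a₃ = a₃, V.a₄ = a₄, V.a₆ = a₆
  rcases Int.even_or_odd' a₁ with ⟨n, rfl | rfl⟩
  · right
    refine ⟨⟨(n ^ 2 + a₂) ^ 2 - 3 * (n * a₃ + a₄), by ring⟩, ?_⟩
    obtain ⟨j, hj⟩ : ∃ j, -((2 * n) ^ 2 + 4 * a₂) ^ 3 +
        36 * ((2 * n) ^ 2 + 4 * a₂) * (2 * a₄ + 2 * n * a₃) - 216 * (a₃ ^ 2 + 4 * a₆) =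
        32 * j + 8 * a₃ ^ 2 :=
      ⟨-2 * (n ^ 2 + a₂) ^ 3 + 9 * (n ^ 2 + a₂) * (n * a₃ + a₄) - 7 * a₃ ^ 2 - 27 * a₆, by ring⟩
    rw [hj]
    rcases Int.even_or_odd' a₃ with ⟨m, rfl | rfl⟩
    · left; ring_nf; omega
    · right; ring_nf; omega
  · left
    obtain ⟨j, hj⟩ : ∃ j, -((2 * n + 1) ^ 2 + 4 * a₂) ^ 3 +
        36 * ((2 * n + 1) ^ 2 + 4 * a₂) * (2 * a₄ + (2 * n + 1) * a₃) - 216 * (a₃ ^ 2 + 4 * a₆) =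
        4 * j - 1 := by
      obtain ⟨q, hq⟩ : ∃ q, (2 * n + 1) ^ 2 + 4 * a₂ = 4 * q + 1 := ⟨n ^ 2 + n + a₂, by ring⟩
      rw [hq]
      exact ⟨-(16 * q ^ 3 + 12 * q ^ 2 + 3 * q) +
        9 * (4 * q + 1) * (2 * a₄ + (2 * n + 1) * a₃) - 54 * (a₃ ^ 2 + 4 * a₆), by ring⟩
    rw [hj]; omega

theorem krausThree_curve (V : WeierstrassCurve ℤ) : KrausThree V.c₆ := by
  intro h
  have h3 : (3 : ℤ) ∣ V.b₂ := by
    refine Int.prime_three.dvd_of_dvd_pow (n := 3) ?_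
    have : V.b₂ ^ 3 = -V.c₆ + 3 * (12 * V.b₂ * V.b₄ - 72 * V.b₆) := by
      rw [WeierstrassCurve.c₆]; ring
    rw [this]
    exact dvd_add ((Dvd.dvd.trans (by norm_num) h).neg_right) (dvd_mul_right _ _)
  obtain ⟨m, hm⟩ := h3
  rw [WeierstrassCurve.c₆, hm]
  exact ⟨-m ^ 3 + 4 * m * V.b₄ - 8 * V.b₆, by ring⟩

theorem krausAt_curve (p : ℕ) (V : WeierstrassCurve ℤ) : KrausAt p V.c₄ V.c₆ :=
  ⟨fun _ => krausTwo_curve V, fun _ => krausThree_curve V⟩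

/-- `27` divides the numerator of `b₄` and `b₆` for the choice `b₂ = -B`. -/
theorem kraus_dvd_three {A B D : ℤ} (h : A ^ 3 - B ^ 2 = 1728 * D) (h3 : KrausThree B) :
    3 ∣ B ^ 2 - A ∧ 27 ∣ B * (B ^ 2 - 3 * A + 2) := by
  have hB : B ^ 2 = A ^ 3 - 1728 * D := by linarith
  have hA : 3 ∣ A ^ 3 - A := by
    have : A % 3 = 0 ∨ A % 3 = 1 ∨ A % 3 = 2 := by omega
    apply Int.dvd_of_emod_eq_zero
    rcases this with h | h | h <;> simp [pow_succ, Int.sub_emod, Int.mul_emod, h]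
  constructor
  · rw [hB]; obtain ⟨q, hq⟩ := hA; exact ⟨q - 576 * D, by linarith⟩
  · by_cases hB3 : (3 : ℤ) ∣ A
    · obtain ⟨a, rfl⟩ := hB3
      have h9 : (9 : ℤ) ∣ B := by
        have h1 : (3 : ℤ) ∣ B := Int.prime_three.dvd_of_dvd_pow (n := 2)
          ⟨9 * a ^ 3 - 576 * D, by rw [hB]; ring⟩
        obtain ⟨b, rfl⟩ := h1
        have h2 : (3 : ℤ) ∣ b := Int.prime_three.dvd_of_dvd_pow (n := 2)
          ⟨a ^ 3 - 64 * D, by linarith⟩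
        obtain ⟨c, rfl⟩ := h2
        exact ⟨c, by ring⟩
      exact (h3 h9).mul_right _
    · have h1 : A % 3 = 1 := by
        rcases (by omega : A % 3 = 1 ∨ A % 3 = 2) with h1 | h1
        · exact h1
        · exfalso
          have h2 : B ^ 2 % 3 = 2 := by
            rw [hB]; simp [pow_succ, Int.sub_emod, Int.mul_emod, h1]
          have : B % 3 = 0 ∨ B % 3 = 1 ∨ B % 3 = 2 := by omega
          rcases this with h | h | h <;> simp [pow_succ, Int.mul_emod, h] at h2
      obtain ⟨i, rfl⟩ : ∃ i, A = 3 * i + 1 := ⟨A / 3, by omega⟩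
      refine Dvd.dvd.mul_left ⟨i ^ 2 * (i + 1) - 64 * D, ?_⟩ _
      rw [hB]; ring

theorem odd_left_of_odd {A B D : ℤ} (h : A ^ 3 - B ^ 2 = 1728 * D) (hB : B % 2 = 1) :
    A % 2 = 1 := by
  by_contra hA
  obtain ⟨a, rfl⟩ : ∃ a, A = 2 * a := ⟨A / 2, by omega⟩
  obtain ⟨b, rfl⟩ : ∃ b, B = 2 * b + 1 := ⟨B / 2, by omega⟩
  ring_nf at h; omega

/-- Kraus's criterion: integers `A`, `B` satisfying his conditions are the invariants `c₄`, `c₆` of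
an integral Weierstrass equation. -/
theorem exists_curve_of_kraus {A B D : ℤ} (h : A ^ 3 - B ^ 2 = 1728 * D) (h2 : KrausTwo A B)
    (h3 : KrausThree B) : ∃ V : WeierstrassCurve ℤ, V.c₄ = A ∧ V.c₆ = B := by
  suffices ∃ a₁ a₂ a₃ a₄ a₆ : ℤ, a₁ ^ 2 + 4 * a₂ = -B ∧ 24 * (2 * a₄ + a₁ * a₃) = B ^ 2 - A ∧
      432 * (a₃ ^ 2 + 4 * a₆) = -(B * (B ^ 2 - 3 * A + 2)) by
    obtain ⟨a₁, a₂, a₃, a₄, a₆, e2, e4, e6⟩ := this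
    refine ⟨⟨a₁, a₂, a₃, a₄, a₆⟩, ?_, ?_⟩
    · simp only [WeierstrassCurve.c₄, WeierstrassCurve.b₂, WeierstrassCurve.b₄]
      rw [e2]; linarith
    · simp only [WeierstrassCurve.c₆, WeierstrassCurve.b₂, WeierstrassCurve.b₄,
        WeierstrassCurve.b₆]
      rw [e2]
      refine mul_left_cancel₀ (two_ne_zero (α := ℤ)) ?_
      linear_combination (-3 * B) * e4 - e6
  obtain ⟨d1, d2⟩ := kraus_dvd_three h h3
  have hB : B ^ 2 = A ^ 3 - 1728 * D := by linarith
  rcases h2 with h2 | ⟨⟨i, rfl⟩, h2⟩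
  · have hodd := odd_left_of_odd h (by omega)
    obtain ⟨i, rfl⟩ : ∃ i, A = 8 * i + 1 := by
      obtain ⟨b, rfl⟩ : ∃ b, B = 4 * b + 3 := ⟨B / 4, by omega⟩
      obtain ⟨a, rfl⟩ : ∃ a, A = 2 * a + 1 := ⟨A / 2, by omega⟩
      obtain ⟨q, hq⟩ := Int.even_mul_succ_self a
      exact ⟨216 * D + 2 * b ^ 2 + 3 * b + 1 - (a ^ 3 + a ^ 2 + q), by linarith⟩
    obtain ⟨j, hj⟩ : ∃ j, B ^ 2 - (8 * i + 1) = 16 * j :=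
      ⟨i * (8 * i + 1) * (4 * i + 1) - 108 * D, by rw [hB]; ring⟩
    obtain ⟨l, hl⟩ : ∃ l, B * (B ^ 2 - 3 * (8 * i + 1) + 2) = 64 * l :=
      ⟨B * (i ^ 2 * (8 * i + 3) - 27 * D), by rw [hB]; ring⟩
    rw [hj] at d1 ⊢
    rw [hl] at d2 ⊢
    refine ⟨1, (-B - 1) / 4, 0, j / 3, -l / 27, ?_, ?_, ?_⟩ <;> omega
  · obtain ⟨b, rfl⟩ : ∃ b, B = 8 * b := ⟨B / 8, by omega⟩
    obtain ⟨j, hj⟩ : ∃ j, (8 * b) ^ 2 - 16 * i = 16 * j := ⟨4 * b ^ 2 - i, by ring⟩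
    obtain ⟨l, hl⟩ : ∃ l, 8 * b * ((8 * b) ^ 2 - 3 * (16 * i) + 2) = 16 * (4 * l + b) :=
      ⟨b * (8 * b ^ 2 - 6 * i), by ring⟩
    rw [hj] at d1 ⊢
    rw [hl] at d2 ⊢
    rcases (by omega : b % 4 = 0 ∨ b % 4 = 1) with hb | hb
    · refine ⟨0, -2 * b, 0, j / 3, -(4 * l + b) / 108, ?_, ?_, ?_⟩ <;> omega
    · refine ⟨0, -2 * b, 1, j / 3, (-(4 * l + b) - 27) / 108, ?_, ?_, ?_⟩ <;> omega

/-- Kraus's condition at `p` is stable under twisting by an integer prime to `p`, which for `p = 2`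
has to be `1` modulo `4`. -/
theorem krausAt_smul {p : ℕ} (hp : p.Prime) {w : ℤ} (hw : ¬ (p : ℤ) ∣ w)
    (hw2 : p = 2 → w % 4 = 1) (a b : ℤ) :
    KrausAt p (w ^ 2 * a) (w ^ 3 * b) ↔ KrausAt p a b := by
  have hc : IsCoprime (p : ℤ) w :=
    (Nat.prime_iff_prime_int.mp hp).coprime_iff_not_dvd.mpr hw
  refine and_congr (imp_congr_right ?_) (imp_congr_right ?_)
  · rintro rfl
    have hA : (16 : ℤ) ∣ w ^ 2 * a ↔ 16 ∣ a := by
      have : IsCoprime (16 : ℤ) (w ^ 2) := by simpa using hc.pow (m := 4) (n := 2)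
      exact ⟨this.dvd_of_dvd_mul_left, fun h => h.mul_left _⟩
    have hB : (8 : ℤ) ∣ w ^ 3 * b ↔ 8 ∣ b := by
      have : IsCoprime (8 : ℤ) (w ^ 3) := by simpa using hc.pow (m := 3) (n := 3)
      exact ⟨this.dvd_of_dvd_mul_left, fun h => h.mul_left _⟩
    obtain ⟨q, hq⟩ : ∃ q, w ^ 3 = 4 * q + 1 := by
      obtain ⟨q, rfl⟩ : ∃ q, w = 4 * q + 1 := ⟨w / 4, by have := hw2 rfl; omega⟩
      exact ⟨16 * q ^ 3 + 12 * q ^ 2 + 3 * q, by ring⟩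
    have e : w ^ 3 * b = 4 * (q * b) + b := by rw [hq]; ring
    simp only [KrausTwo, hA]
    refine or_congr ?_ (and_congr_right fun _ => ?_)
    · rw [e]; omega
    · by_cases h8 : (8 : ℤ) ∣ b
      · obtain ⟨c, rfl⟩ := h8
        have e' : w ^ 3 * (8 * c) = 32 * (q * c) + 8 * c := by rw [hq]; ring
        rw [e']; omega
      · have := mt hB.mp h8
        omega
  · rintro rfl
    have h1 : (9 : ℤ) ∣ w ^ 3 * b ↔ 9 ∣ b := by
      have : IsCoprime (9 : ℤ) (w ^ 3) := by simpa using hc.pow (m := 2) (n := 3)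
      exact ⟨this.dvd_of_dvd_mul_left, fun h => h.mul_left _⟩
    have h2 : (27 : ℤ) ∣ w ^ 3 * b ↔ 27 ∣ b := by
      have : IsCoprime (27 : ℤ) (w ^ 3) := by simpa using hc.pow (m := 3) (n := 3)
      exact ⟨this.dvd_of_dvd_mul_left, fun h => h.mul_left _⟩
    simp only [KrausThree, h1, h2]

theorem exists_eq_mul_of_mul_eq {m w A a : ℤ} (hc : IsCoprime m w) (hm : m ≠ 0)
    (h : w * A = m * a) : ∃ a', A = m * a' ∧ a = w * a' := by
  obtain ⟨a', rfl⟩ := hc.dvd_of_dvd_mul_left (Dvd.intro a h.symm)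
  exact ⟨a', rfl, mul_left_cancel₀ hm (by linear_combination -h)⟩

theorem admissible_smul {p : ℕ} (hp : p.Prime) {w : ℤ} (hw : ¬ (p : ℤ) ∣ w)
    (hw2 : p = 2 → w % 4 = 1) (k : ℕ) (A B D : ℤ) :
    Admissible p k (w ^ 2 * A) (w ^ 3 * B) (w ^ 6 * D) ↔ Admissible p k A B D := by
  have hc : IsCoprime (p : ℤ) w :=
    (Nat.prime_iff_prime_int.mp hp).coprime_iff_not_dvd.mpr hw
  have h0 : (p : ℤ) ≠ 0 := by exact_mod_cast hp.ne_zero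
  constructor
  · rintro ⟨a, b, c, ha, hb, hD, hk⟩
    obtain ⟨a', rfl, rfl⟩ := exists_eq_mul_of_mul_eq hc.pow (pow_ne_zero _ h0) ha
    obtain ⟨b', rfl, rfl⟩ := exists_eq_mul_of_mul_eq hc.pow (pow_ne_zero _ h0) hb
    obtain ⟨c', rfl, rfl⟩ := exists_eq_mul_of_mul_eq hc.pow (pow_ne_zero _ h0) hD
    exact ⟨a', b', c', rfl, rfl, rfl, (krausAt_smul hp hw hw2 _ _).mp hk⟩
  · rintro ⟨a, b, c, rfl, rfl, rfl, hk⟩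
    exact ⟨w ^ 2 * a, w ^ 3 * b, w ^ 6 * c, by ring, by ring, by ring,
      (krausAt_smul hp hw hw2 _ _).mpr hk⟩

theorem sq_emod_four_of_not_two_dvd {p : ℕ} {m : ℤ} (hm : ¬ (p : ℤ) ∣ m) (hp : p = 2) :
    m ^ 2 % 4 = 1 := by
  subst hp
  obtain ⟨n, rfl⟩ : ∃ n, m = 2 * n + 1 := ⟨m / 2, by omega⟩
  ring_nf; omega

theorem not_dvd_sq {p : ℕ} (hp : p.Prime) {m : ℤ} (hm : ¬ (p : ℤ) ∣ m) : ¬ (p : ℤ) ∣ m ^ 2 :=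
  fun h => hm ((Nat.prime_iff_prime_int.mp hp).dvd_of_dvd_pow h)

theorem krausAt_scale {p : ℕ} (hp : p.Prime) {m : ℤ} (hm : ¬ (p : ℤ) ∣ m) (a b : ℤ) :
    KrausAt p (m ^ 4 * a) (m ^ 6 * b) ↔ KrausAt p a b := by
  rw [← krausAt_smul hp (not_dvd_sq hp hm) (sq_emod_four_of_not_two_dvd hm) a b]
  ring_nf

theorem admissible_scale {p : ℕ} (hp : p.Prime) {m : ℤ} (hm : ¬ (p : ℤ) ∣ m) (k : ℕ)
    (A B D : ℤ) :
    Admissible p k (m ^ 4 * A) (m ^ 6 * B) (m ^ 12 * D) ↔ Admissible p k A B D := by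
  rw [← admissible_smul hp (not_dvd_sq hp hm) (sq_emod_four_of_not_two_dvd hm) k A B D]
  ring_nf

theorem admissible_add {p : ℕ} (hp : p.Prime) (k j : ℕ) (A B D : ℤ) :
    Admissible p (k + j) ((p ^ k : ℤ) ^ 4 * A) ((p ^ k : ℤ) ^ 6 * B) ((p ^ k : ℤ) ^ 12 * D) ↔
      Admissible p j A B D := by
  have h0 : (p : ℤ) ≠ 0 := by exact_mod_cast hp.ne_zero
  have e (n : ℕ) (x y : ℤ) :
      (p ^ k : ℤ) ^ n * x = (p : ℤ) ^ (n * (k + j)) * y ↔ x = (p : ℤ) ^ (n * j) * y := by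
    rw [← pow_mul, mul_comm k n, mul_add, pow_add, mul_assoc]
    exact mul_right_inj' (pow_ne_zero _ h0)
  simp only [Admissible, e]

theorem admissible_zero (p : ℕ) (A B D : ℤ) : Admissible p 0 A B D ↔ KrausAt p A B := by
  constructor
  · rintro ⟨a, b, c, rfl, rfl, rfl, hk⟩; simpa using hk
  · intro h; exact ⟨A, B, D, by simp, by simp, by simp, h⟩

/-- Two Weierstrass equations over a field whose invariants `c₄`, `c₆` differ by the factors `u⁴`,
`u⁶` are related by a change of variables with scaling factor `u`. -/
theorem exists_variableChange {K : Type*} [Field K] [CharZero K] (W W' : WeierstrassCurve K)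
    (u : Kˣ) (h4 : W.c₄ = u ^ 4 * W'.c₄) (h6 : W.c₆ = u ^ 6 * W'.c₆) :
    ∃ r s t : K, (⟨u, r, s, t⟩ : WeierstrassCurve.VariableChange K) • W = W' := by
  obtain ⟨r, hr⟩ : ∃ r, r = (u ^ 2 * W'.b₂ - W.b₂) / 12 := ⟨_, rfl⟩
  obtain ⟨s, hs⟩ : ∃ s, s = (u * W'.a₁ - W.a₁) / 2 := ⟨_, rfl⟩
  obtain ⟨t, ht⟩ : ∃ t, t = (u ^ 3 * W'.a₃ - W.a₃ - r * W.a₁) / 2 := ⟨_, rfl⟩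
  refine ⟨r, s, t, ?_⟩
  obtain ⟨V, hV⟩ : ∃ V, (⟨u, r, s, t⟩ : WeierstrassCurve.VariableChange K) • W = V := ⟨_, rfl⟩
  have hu : (u : K) ≠ 0 := u.ne_zero
  have h1 : V.a₁ = W'.a₁ := by
    rw [← hV, WeierstrassCurve.variableChange_a₁]; simp only [hs, Units.val_inv_eq_inv_val]
    field_simp; ring
  have h3 : V.a₃ = W'.a₃ := by
    rw [← hV, WeierstrassCurve.variableChange_a₃]; simp only [ht, Units.val_inv_eq_inv_val]
    field_simp; ring
  have hb2 : V.b₂ = W'.b₂ := by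
    rw [← hV, WeierstrassCurve.variableChange_b₂]; simp only [hr, Units.val_inv_eq_inv_val]
    field_simp; ring
  have hc4 : V.c₄ = W'.c₄ := by
    rw [← hV, WeierstrassCurve.variableChange_c₄, h4]; simp only [Units.val_inv_eq_inv_val]
    field_simp
  have hc6 : V.c₆ = W'.c₆ := by
    rw [← hV, WeierstrassCurve.variableChange_c₆, h6]; simp only [Units.val_inv_eq_inv_val]
    field_simp
  have hb4 : V.b₄ = W'.b₄ := by
    rw [WeierstrassCurve.c₄, WeierstrassCurve.c₄, hb2] at hc4
    exact mul_left_cancel₀ (by norm_num : (24 : K) ≠ 0) (by linear_combination -hc4)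
  have hb6 : V.b₆ = W'.b₆ := by
    rw [WeierstrassCurve.c₆, WeierstrassCurve.c₆, hb2, hb4] at hc6
    exact mul_left_cancel₀ (by norm_num : (216 : K) ≠ 0) (by linear_combination -hc6)
  have h2 : V.a₂ = W'.a₂ := by
    rw [WeierstrassCurve.b₂, WeierstrassCurve.b₂, h1] at hb2
    exact mul_left_cancel₀ (by norm_num : (4 : K) ≠ 0) (by linear_combination hb2)
  have h4' : V.a₄ = W'.a₄ := by
    rw [WeierstrassCurve.b₄, WeierstrassCurve.b₄, h1, h3] at hb4
    exact mul_left_cancel₀ (by norm_num : (2 : K) ≠ 0) (by linear_combination hb4)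
  have h6' : V.a₆ = W'.a₆ := by
    rw [WeierstrassCurve.b₆, WeierstrassCurve.b₆, h3] at hb6
    exact mul_left_cancel₀ (by norm_num : (4 : K) ≠ 0) (by linear_combination hb6)
  rw [hV]
  exact WeierstrassCurve.ext h1 h2 h3 h4' h6'

/-- The adic valuation of the ring of `p`-integral rationals has the same maximal ideal as the
`p`-adic valuation. -/
theorem adicValuation_lt_one_iff (p : ℕ) [Fact p.Prime] (x : ℚ) :
    (IsDiscreteValuationRing.maximalIdeal (Rat.padicValuation p).valuationSubring).valuation ℚ x < 1
      ↔ Rat.padicValuation p x < 1 := by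
  have key (a : (Rat.padicValuation p).valuationSubring) :
      (IsDiscreteValuationRing.maximalIdeal
        (Rat.padicValuation p).valuationSubring).valuation ℚ (a : ℚ) < 1 ↔
        Rat.padicValuation p (a : ℚ) < 1 := by
    refine (IsDedekindDomain.HeightOneSpectrum.valuation_lt_one_iff_mem (K := ℚ) _ a).trans ?_
    change a ∈ IsLocalRing.maximalIdeal _ ↔ _
    rw [IsLocalRing.mem_maximalIdeal, mem_nonunits_iff, ← not_le, not_iff_not]
    constructor
    · rintro ⟨⟨b, c, h, -⟩, rfl⟩
      have h1 : Rat.padicValuation p (b : ℚ) * Rat.padicValuation p (c : ℚ) = 1 := by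
        rw [← map_mul, ← map_one (Rat.padicValuation p)]
        exact congrArg _ (congrArg Subtype.val h)
      calc (1 : WithZero (Multiplicative ℤ)) = _ := h1.symm
        _ ≤ Rat.padicValuation p (b : ℚ) * 1 := mul_le_mul_right c.2 _
        _ = _ := mul_one _
    · intro h
      have h0 : (a : ℚ) ≠ 0 := by
        intro h0; rw [h0, map_zero] at h; exact absurd h (by simp)
      have hi : Rat.padicValuation p (a : ℚ)⁻¹ ≤ 1 := by
        rw [map_inv₀]; exact inv_le_one_of_one_le₀ h
      exact ⟨⟨a, ⟨_, hi⟩, Subtype.ext (mul_inv_cancel₀ h0), Subtype.ext (inv_mul_cancel₀ h0)⟩, rfl⟩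
  constructor
  · intro h
    obtain ⟨a, rfl⟩ := IsDiscreteValuationRing.exists_lift_of_le_one h.le
    exact (key a).mp h
  · intro h
    exact (key ⟨x, h.le⟩).mpr h

theorem isIntegral_map (p : ℕ) [Fact p.Prime] (V : WeierstrassCurve ℤ) :
    (V.map (Int.castRingHom ℚ)).IsIntegral (Rat.padicValuation p).valuationSubring :=
  ⟨V.map (Int.castRingHom _), by
    rw [WeierstrassCurve.baseChange, WeierstrassCurve.map_map]; congr 1⟩

/-- A `p`-integral equation becomes integral after scaling by a suitable integer prime to `p`. -/
theorem exists_integral_scale {p : ℕ} [hp : Fact p.Prime] (W : WeierstrassCurve ℚ)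
    (h : W.IsIntegral (Rat.padicValuation p).valuationSubring) :
    ∃ m : ℤ, ¬ (p : ℤ) ∣ m ∧ ∀ n : ℤ, ∃ V : WeierstrassCurve ℤ,
      (V.c₄ : ℚ) = (m * n) ^ 4 * W.c₄ ∧ (V.c₆ : ℚ) = (m * n) ^ 6 * W.c₆ ∧
        (V.Δ : ℚ) = (m * n) ^ 12 * W.Δ := by
  have hden (x : (Rat.padicValuation p).valuationSubring) : ¬ p ∣ (x : ℚ).den :=
    Rat.padicValuation_le_one_iff.mp x.2
  obtain ⟨⟨x₁, x₂, x₃, x₄, x₆⟩, rfl⟩ := h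
  refine ⟨((x₁ : ℚ).den * (x₂ : ℚ).den * (x₃ : ℚ).den * (x₄ : ℚ).den * (x₆ : ℚ).den : ℕ), ?_,
    fun n => ?_⟩
  · rw [Int.natCast_dvd_natCast]
    simp only [hp.out.dvd_mul, hden, or_false, not_false_eq_true]
  · obtain ⟨m, hm⟩ : ∃ m : ℕ, m = (x₁ : ℚ).den * (x₂ : ℚ).den * (x₃ : ℚ).den * (x₄ : ℚ).den *
      (x₆ : ℚ).den := ⟨_, rfl⟩
    rw [← hm]
    have hint (x : ℚ) (hx : x.den ∣ m) : ∃ z : ℤ, (z : ℚ) = m * x := by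
      obtain ⟨q, rfl⟩ := hx
      refine ⟨q * x.num, ?_⟩
      have := Rat.mul_den_eq_num x
      push_cast
      linear_combination -(q : ℚ) * this
    obtain ⟨z₁, h₁⟩ := hint x₁ ⟨_, by rw [hm]; simp only [mul_assoc]; rfl⟩
    obtain ⟨z₂, h₂⟩ := hint x₂ ⟨(x₁ : ℚ).den * (x₃ : ℚ).den * (x₄ : ℚ).den * (x₆ : ℚ).den,
      by rw [hm]; ring⟩
    obtain ⟨z₃, h₃⟩ := hint x₃ ⟨(x₁ : ℚ).den * (x₂ : ℚ).den * (x₄ : ℚ).den * (x₆ : ℚ).den,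
      by rw [hm]; ring⟩
    obtain ⟨z₄, h₄⟩ := hint x₄ ⟨(x₁ : ℚ).den * (x₂ : ℚ).den * (x₃ : ℚ).den * (x₆ : ℚ).den,
      by rw [hm]; ring⟩
    obtain ⟨z₆, h₆⟩ := hint x₆ ⟨(x₁ : ℚ).den * (x₂ : ℚ).den * (x₃ : ℚ).den * (x₄ : ℚ).den,
      by rw [hm]; ring⟩
    refine ⟨⟨n * z₁, m * n ^ 2 * z₂, m ^ 2 * n ^ 3 * z₃, m ^ 3 * n ^ 4 * z₄, m ^ 5 * n ^ 6 * z₆⟩,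
      ?_⟩
    rw [WeierstrassCurve.baseChange, WeierstrassCurve.map_c₄, WeierstrassCurve.map_c₆,
      WeierstrassCurve.map_Δ]
    have e (x : (Rat.padicValuation p).valuationSubring) : algebraMap _ ℚ x = (x : ℚ) := rfl
    refine ⟨?_, ?_, ?_⟩ <;>
    · simp only [WeierstrassCurve.c₄, WeierstrassCurve.c₆, WeierstrassCurve.Δ,
        WeierstrassCurve.b₂, WeierstrassCurve.b₄, WeierstrassCurve.b₆, WeierstrassCurve.b₈]
      push_cast
      simp only [h₁, h₂, h₃, h₄, h₆, map_ofNat, e]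
      ring

theorem three_two_relation (V : WeierstrassCurve ℤ) : V.c₄ ^ 3 - V.c₆ ^ 2 = 1728 * V.Δ :=
  V.c_relation.symm

theorem adicValuation_prime_lt_one (p : ℕ) [hp : Fact p.Prime] :
    (IsDiscreteValuationRing.maximalIdeal (Rat.padicValuation p).valuationSubring).valuation ℚ
      (p : ℚ) < 1 := by
  rw [adicValuation_lt_one_iff, ← Int.cast_natCast, Rat.padicValuation_cast,
    Int.padicValuation_lt_one_iff]

theorem map_c₄_cast (V : WeierstrassCurve ℤ) : (V.map (Int.castRingHom ℚ)).c₄ = V.c₄ := by simp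

theorem map_c₆_cast (V : WeierstrassCurve ℤ) : (V.map (Int.castRingHom ℚ)).c₆ = V.c₆ := by simp

theorem map_Δ_cast (V : WeierstrassCurve ℤ) : (V.map (Int.castRingHom ℚ)).Δ = V.Δ := by simp

theorem not_admissible_one_of_isMinimal {V : WeierstrassCurve ℤ} (hΔ : V.Δ ≠ 0) {p : ℕ}
    [hp : Fact p.Prime]
    (h : (V.map (Int.castRingHom ℚ)).IsMinimal (Rat.padicValuation p).valuationSubring) :
    ¬ Admissible p 1 V.c₄ V.c₆ V.Δ := by
  rintro ⟨a, b, c, ha, hb, hc, hk⟩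
  simp only [mul_one] at ha hb hc
  have hp0 : (p : ℤ) ≠ 0 := by exact_mod_cast hp.out.ne_zero
  have hrel : a ^ 3 - b ^ 2 = 1728 * c := by
    have := three_two_relation V
    rw [ha, hb, hc] at this
    exact mul_left_cancel₀ (pow_ne_zero 12 hp0) (by linear_combination this)
  have hkraus (q : ℕ) (hq : q.Prime) : KrausAt q a b := by
    by_cases hqp : q = p
    · rw [hqp]; exact hk
    · rw [← krausAt_scale hq (m := p) (fun hd => hqp ((Nat.prime_dvd_prime_iff_eq hq hp.out).mp
        (Int.natCast_dvd_natCast.mp hd))), ← ha, ← hb]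
      exact krausAt_curve q V
  obtain ⟨V', h4, h6⟩ := exists_curve_of_kraus hrel ((hkraus 2 Nat.prime_two).1 rfl)
    ((hkraus 3 Nat.prime_three).2 rfl)
  have hp0' : (p : ℚ) ≠ 0 := by exact_mod_cast hp.out.ne_zero
  obtain ⟨r, s, t, hC⟩ := exists_variableChange (V.map (Int.castRingHom ℚ))
    (V'.map (Int.castRingHom ℚ)) (Units.mk0 (p : ℚ) hp0')
    (by rw [map_c₄_cast, map_c₄_cast, ha, h4]; push_cast; rfl)
    (by rw [map_c₆_cast, map_c₆_cast, hb, h6]; push_cast; rfl)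
  have hV := isIntegral_map p V
  have hV' := isIntegral_map p V'
  have hD : (V.Δ : ℚ) = (p : ℚ) ^ 12 * V'.Δ := by
    have := congrArg WeierstrassCurve.Δ hC
    rw [WeierstrassCurve.variableChange_Δ, map_Δ_cast, map_Δ_cast] at this
    rw [← this, Units.val_inv_eq_inv_val, Units.val_mk0]
    field_simp
  have hlt := adicValuation_prime_lt_one p
  set v := (IsDiscreteValuationRing.maximalIdeal
    (Rat.padicValuation p).valuationSubring).valuation ℚ with hv
  have hvD : v V.Δ = v p ^ 12 * v V'.Δ := by rw [hD, map_mul, map_pow]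
  have hv0 : 0 < v V'.Δ := by
    refine zero_lt_iff.mpr fun h0 => ?_
    rw [h0, mul_zero, map_eq_zero] at hvD
    exact hΔ (by exact_mod_cast hvD)
  have hlt' : v V.Δ < v V'.Δ := by
    rw [hvD]
    calc v p ^ 12 * v V'.Δ < 1 * v V'.Δ :=
          mul_lt_mul_of_pos_right (pow_lt_one₀ zero_le hlt (by norm_num)) hv0
      _ = v V'.Δ := one_mul _
  have e1 : (WeierstrassCurve.valuation_Δ_aux (Rat.padicValuation p).valuationSubring
      (V.map (Int.castRingHom ℚ)) : WithZero (Multiplicative ℤ)) = v V.Δ := by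
    rw [WeierstrassCurve.valuation_Δ_aux_eq_of_isIntegral, map_Δ_cast]
  have e2 : (WeierstrassCurve.valuation_Δ_aux (Rat.padicValuation p).valuationSubring
      (V'.map (Int.castRingHom ℚ)) : WithZero (Multiplicative ℤ)) = v V'.Δ := by
    rw [WeierstrassCurve.valuation_Δ_aux_eq_of_isIntegral, map_Δ_cast]
  have := h.val_Δ_maximal.2 (j := ⟨Units.mk0 (p : ℚ) hp0', r, s, t⟩)
    (by beta_reduce; rw [hC]; exact hV')
  simp only [one_smul, hC, ← Subtype.coe_le_coe, e1, e2] at this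
  exact absurd (this hlt'.le) (not_le.mpr hlt')

theorem isMinimal_of_not_admissible_one {V : WeierstrassCurve ℤ} {p : ℕ}
    [hp : Fact p.Prime] (h : ¬ Admissible p 1 V.c₄ V.c₆ V.Δ) :
    (V.map (Int.castRingHom ℚ)).IsMinimal (Rat.padicValuation p).valuationSubring := by
  have hV := isIntegral_map p V
  refine ⟨⟨by beta_reduce; rw [one_smul]; exact hV, fun C hC _ => ?_⟩⟩
  beta_reduce at hC ⊢
  rw [← Subtype.coe_le_coe, one_smul, WeierstrassCurve.valuation_Δ_aux_eq_of_isIntegral,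
    WeierstrassCurve.valuation_Δ_aux_eq_of_isIntegral]
  by_contra hlt
  rw [WeierstrassCurve.variableChange_Δ, map_mul, map_pow] at hlt
  have hu0 : (C.u : ℚ) ≠ 0 := C.u.ne_zero
  have hu : Rat.padicValuation p (C.u : ℚ) < 1 := by
    rw [← adicValuation_lt_one_iff]
    by_contra h1
    refine hlt ?_
    rw [Units.val_inv_eq_inv_val, map_inv₀, inv_pow]
    exact mul_le_of_le_one_left' (inv_le_one_of_one_le₀ (one_le_pow₀ (not_lt.mp h1)))
  have hden : ¬ p ∣ (C.u : ℚ).den := Rat.padicValuation_le_one_iff.mp hu.le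
  obtain ⟨n, hn⟩ : (p : ℤ) ∣ (C.u : ℚ).num := by
    rw [← Int.padicValuation_lt_one_iff, ← Rat.padicValuation_cast, ← Rat.mul_den_eq_num, map_mul]
    exact mul_lt_one_of_lt_of_le hu
      (by rw [← Int.cast_natCast, Rat.padicValuation_cast]; exact Int.padicValuation_le_one p _)
  obtain ⟨m, hm, hscale⟩ := exists_integral_scale _ hC
  obtain ⟨V', h4, h6, hD⟩ := hscale n
  have hue : (C.u : ℚ) * (C.u : ℚ).den = p * n := by
    rw [Rat.mul_den_eq_num, hn]; push_cast; rfl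
  obtain ⟨e, he⟩ : ∃ e : ℤ, e = (C.u : ℚ).den := ⟨_, rfl⟩
  have hue' : (C.u : ℚ) * e = p * n := by rw [he, ← hue]; push_cast; rfl
  have hme : ¬ (p : ℤ) ∣ m * e := by
    rw [(Nat.prime_iff_prime_int.mp hp.out).dvd_mul, not_or, he, Int.natCast_dvd_natCast]
    exact ⟨hm, hden⟩
  refine h ((admissible_scale hp.out hme 1 _ _ _).mp ⟨V'.c₄, V'.c₆, V'.Δ, ?_, ?_, ?_,
    krausAt_curve p V'⟩)
  · have : ((p : ℚ) * n) ^ 4 = (C.u : ℚ) ^ 4 * e ^ 4 := by rw [← hue', mul_pow]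
    rw [WeierstrassCurve.variableChange_c₄, map_c₄_cast, Units.val_inv_eq_inv_val] at h4
    have : ((m * e : ℤ) ^ 4 * V.c₄ : ℚ) = (p : ℚ) ^ 4 * V'.c₄ := by
      rw [h4]
      calc ((m * e : ℤ) ^ 4 * V.c₄ : ℚ) =
            m ^ 4 * ((C.u : ℚ) ^ 4 * e ^ 4) * ((C.u : ℚ)⁻¹ ^ 4 * V.c₄) := by
            push_cast; field_simp
        _ = _ := by rw [← this]; ring
    exact_mod_cast this
  · have : ((p : ℚ) * n) ^ 6 = (C.u : ℚ) ^ 6 * e ^ 6 := by rw [← hue', mul_pow]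
    rw [WeierstrassCurve.variableChange_c₆, map_c₆_cast, Units.val_inv_eq_inv_val] at h6
    have : ((m * e : ℤ) ^ 6 * V.c₆ : ℚ) = (p : ℚ) ^ 6 * V'.c₆ := by
      rw [h6]
      calc ((m * e : ℤ) ^ 6 * V.c₆ : ℚ) =
            m ^ 6 * ((C.u : ℚ) ^ 6 * e ^ 6) * ((C.u : ℚ)⁻¹ ^ 6 * V.c₆) := by
            push_cast; field_simp
        _ = _ := by rw [← this]; ring
    exact_mod_cast this
  · have : ((p : ℚ) * n) ^ 12 = (C.u : ℚ) ^ 12 * e ^ 12 := by rw [← hue', mul_pow]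
    rw [WeierstrassCurve.variableChange_Δ, map_Δ_cast, Units.val_inv_eq_inv_val] at hD
    have : ((m * e : ℤ) ^ 12 * V.Δ : ℚ) = (p : ℚ) ^ 12 * V'.Δ := by
      rw [hD]
      calc ((m * e : ℤ) ^ 12 * V.Δ : ℚ) =
            m ^ 12 * ((C.u : ℚ) ^ 12 * e ^ 12) * ((C.u : ℚ)⁻¹ ^ 12 * V.Δ) := by
            push_cast; field_simp
        _ = _ := by rw [← this]; ring
    exact_mod_cast this

theorem admissible_two_iff (k : ℕ) (A B D : ℤ) :
    Admissible 2 k A B D ↔ 2 ^ (4 * k) ∣ A ∧ 2 ^ (6 * k) ∣ B ∧ 2 ^ (12 * k) ∣ D ∧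
      KrausTwo (A / 2 ^ (4 * k)) (B / 2 ^ (6 * k)) := by
  have h (n : ℕ) : (2 : ℤ) ^ n ≠ 0 := pow_ne_zero _ two_ne_zero
  constructor
  · rintro ⟨a, b, c, rfl, rfl, rfl, hk⟩
    have := hk.1 rfl
    simpa [h] using this
  · rintro ⟨⟨a, rfl⟩, ⟨b, rfl⟩, ⟨c, rfl⟩, hk⟩
    refine ⟨a, b, c, rfl, rfl, rfl, fun _ => ?_, fun h3 => absurd h3 (by decide)⟩
    simpa [h] using hk

theorem not_two_dvd_disc {A B D : ℤ} (h : A ^ 3 - B ^ 2 = 1728 * D) (hA : 16 ∣ A) (hB : 8 ∣ B)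
    (hB' : ¬ 16 ∣ B) : ¬ 2 ∣ D := by
  obtain ⟨a, rfl⟩ := hA
  obtain ⟨b, rfl⟩ := hB
  obtain ⟨c, rfl⟩ : ∃ c, b = 2 * c + 1 := ⟨b / 2, by omega⟩
  have : 64 * a ^ 3 - 4 * c ^ 2 - 4 * c - 1 = 27 * D := by linarith
  omega

theorem not_thirtyTwo_dvd {A B D : ℤ} (h : A ^ 3 - B ^ 2 = 1728 * D) (hA : 16 ∣ A) (hB : 64 ∣ B)
    (hB' : ¬ 128 ∣ B) (hD : 4096 ∣ D) : ¬ 32 ∣ A := by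
  rintro ⟨a, rfl⟩
  obtain ⟨b, rfl⟩ := hB
  obtain ⟨c, rfl⟩ : ∃ c, b = 2 * c + 1 := ⟨b / 2, by omega⟩
  obtain ⟨e, rfl⟩ := hD
  have : 8 * a ^ 3 - 4 * c ^ 2 - 4 * c - 1 = 1728 * e := by linarith
  omega

theorem two_pow_twelve_dvd_disc {A B D : ℤ} (h : A ^ 3 - B ^ 2 = 1728 * D) (hA : 256 ∣ A)
    (hB : 512 ∣ B) (hB' : ¬ 1024 ∣ B) : 4096 ∣ D ∧ ¬ 8192 ∣ D := by
  obtain ⟨a, rfl⟩ := hA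
  obtain ⟨b, rfl⟩ := hB
  obtain ⟨c, rfl⟩ : ∃ c, b = 2 * c + 1 := ⟨b / 2, by omega⟩
  have : 262144 * a ^ 3 - 16384 * c ^ 2 - 16384 * c - 4096 = 27 * D := by linarith
  have : ∃ q, q = c ^ 2 + c := ⟨_, rfl⟩
  omega

theorem two_pow_six_dvd_disc {A B D : ℤ} (h : A ^ 3 - B ^ 2 = 1728 * D) (hA : 64 ∣ A)
    (hB : 64 ∣ B) : 64 ∣ D ∧ (¬ 128 ∣ B → ¬ 128 ∣ D) := by
  obtain ⟨a, rfl⟩ := hA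
  obtain ⟨b, rfl⟩ := hB
  have : 4096 * a ^ 3 - 64 * b ^ 2 = 27 * D := by linarith
  refine ⟨by omega, fun hb => ?_⟩
  obtain ⟨c, rfl⟩ : ∃ c, b = 2 * c + 1 := ⟨b / 2, by omega⟩
  have : 4096 * a ^ 3 - 64 * (4 * c ^ 2 + 4 * c + 1) = 27 * D := by linarith
  omega

theorem two_pow_six_dvd_left {A B D : ℤ} (h : A ^ 3 - B ^ 2 = 1728 * D) (hA : 16 ∣ A)
    (hB : 512 ∣ B) (hB' : ¬ 1024 ∣ B) (hD : 262144 ∣ D) : 64 ∣ A ∧ ¬ 128 ∣ A := by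
  obtain ⟨a, rfl⟩ := hA
  obtain ⟨b, rfl⟩ := hB
  obtain ⟨e, rfl⟩ := hD
  have h1 : a ^ 3 - 64 * b ^ 2 = 110592 * e := by linarith
  obtain ⟨c, rfl⟩ : (2 : ℤ) ∣ a := Int.prime_two.dvd_of_dvd_pow (n := 3) ⟨_, by
    rw [(by linarith : a ^ 3 = 2 * (55296 * e + 32 * b ^ 2))]⟩
  obtain ⟨f, rfl⟩ : (2 : ℤ) ∣ c := Int.prime_two.dvd_of_dvd_pow (n := 3) ⟨_, by
    rw [(by linarith : c ^ 3 = 2 * (6912 * e + 4 * b ^ 2))]⟩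
  refine ⟨⟨f, by ring⟩, fun hd => ?_⟩
  obtain ⟨g, rfl⟩ : ∃ g, f = 2 * g := ⟨f / 2, by omega⟩
  obtain ⟨i, rfl⟩ : ∃ i, b = 2 * i + 1 := ⟨b / 2, by omega⟩
  have : 8 * g ^ 3 - (4 * i ^ 2 + 4 * i + 1) = 1728 * e := by linarith
  omega

/-- The local computation at `2` for a twist by an integer congruent to `3` modulo `4`. -/
theorem admissible_two_of_three_mod_four {A B D : ℤ} (h : A ^ 3 - B ^ 2 = 1728 * D)
    (hK : KrausTwo A B) (hmin : ¬ Admissible 2 1 A B D) :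
    if (¬ 2 ∣ A ∧ ¬ 2 ∣ B) ∨ (16 ∣ A ∧ (8 ∣ B ∧ ¬ 16 ∣ B) ∧ ¬ 2 ∣ D) then
      Admissible 2 0 (16 * A) (64 * -B) (4096 * D) ∧
        ¬ Admissible 2 1 (16 * A) (64 * -B) (4096 * D)
    else if ((16 ∣ A ∧ ¬ 32 ∣ A) ∧ (64 ∣ B ∧ ¬ 128 ∣ B) ∧ 4096 ∣ D ∧ B / 64 % 4 = 1) ∨
        (256 ∣ A ∧ (512 ∣ B ∧ ¬ 1024 ∣ B) ∧ (4096 ∣ D ∧ ¬ 8192 ∣ D) ∧ B / 512 % 4 = 3) then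
      Admissible 2 2 (16 * A) (64 * -B) (4096 * D) ∧
        ¬ Admissible 2 3 (16 * A) (64 * -B) (4096 * D)
    else
      Admissible 2 1 (16 * A) (64 * -B) (4096 * D) ∧
        ¬ Admissible 2 2 (16 * A) (64 * -B) (4096 * D) := by
  have r1 : B % 2 = 1 → A % 2 = 1 := odd_left_of_odd h
  have r2 := not_two_dvd_disc h
  have r3 := not_thirtyTwo_dvd h
  have r4 := two_pow_twelve_dvd_disc h
  clear h
  simp only [admissible_two_iff, KrausTwo, Nat.reduceMul, Int.reducePow] at hK hmin ⊢
  split_ifs with h1 h2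
  · clear r1 r2 r3 r4 hmin
    rcases h1 with h1 | ⟨h1, h1', -⟩ <;> rcases hK with hK | hK <;> omega
  · clear r1 r2 r3 r4 hmin h1 hK
    rcases h2 with h2 | h2
    · refine ⟨⟨by omega, by omega, by omega, by omega⟩, by omega⟩
    · refine ⟨⟨by omega, by omega, by omega, by omega⟩, by omega⟩
  · obtain ⟨hA, hB⟩ : 16 ∣ A ∧ B % 32 = 0 := by
      clear r3 r4 hmin h2
      rcases hK with hK | ⟨hA, hK | hK⟩
      · have := r1 (by omega); omega
      · exact ⟨hA, hK⟩
      · have := r2 hA (by omega) (by omega); omega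
    clear r1 r2 hK h1
    refine ⟨⟨by omega, by omega, by omega, by omega⟩, ?_⟩
    rintro ⟨-, h6, hD, hk | ⟨h4, hk | hk⟩⟩
    · have := r3 hA (by omega) (by omega) (by omega)
      clear r3 r4 hmin; omega
    · clear r3 r4 h2; omega
    · have := r4 (by omega) (by omega) (by omega)
      clear r3 r4 hmin; omega

/-- The local computation at `2` for a twist by an even square-free integer; here `B'` is `±B`. -/
theorem admissible_two_of_two_mod_four {A B B' D : ℤ} (h : A ^ 3 - B ^ 2 = 1728 * D)
    (hK : KrausTwo A B) (hmin : ¬ Admissible 2 1 A B D) (hB' : B' = B ∨ B' = -B) :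
    if ¬ 2 ∣ A ∧ ¬ 2 ∣ B then
      Admissible 2 0 (64 * A) (512 * B') (262144 * D) ∧
        ¬ Admissible 2 1 (64 * A) (512 * B') (262144 * D)
    else if (64 ∣ A ∧ ¬ 128 ∣ A) ∧ (512 ∣ B ∧ ¬ 1024 ∣ B) ∧ 262144 ∣ D ∧ B' / 512 % 4 = 3 then
      Admissible 2 3 (64 * A) (512 * B') (262144 * D) ∧
        ¬ Admissible 2 4 (64 * A) (512 * B') (262144 * D)
    else if ((16 ∣ A ∧ ¬ 32 ∣ A) ∨ (32 ∣ A ∧ ¬ 64 ∣ A)) ∨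
        ((8 ∣ B ∧ ¬ 16 ∣ B) ∨ (32 ∣ B ∧ ¬ 64 ∣ B) ∨ (128 ∣ B ∧ ¬ 256 ∣ B)) ∨
        (64 ∣ A ∧ (64 ∣ B ∧ ¬ 128 ∣ B) ∧ (64 ∣ D ∧ ¬ 128 ∣ D) ∧ B' / 64 % 4 = 3) then
      Admissible 2 1 (64 * A) (512 * B') (262144 * D) ∧
        ¬ Admissible 2 2 (64 * A) (512 * B') (262144 * D)
    else
      Admissible 2 2 (64 * A) (512 * B') (262144 * D) ∧
        ¬ Admissible 2 3 (64 * A) (512 * B') (262144 * D) := by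
  have r1 : B % 2 = 1 → A % 2 = 1 := odd_left_of_odd h
  have r2 := not_two_dvd_disc h
  have r5 := two_pow_six_dvd_disc h
  have r7 := two_pow_six_dvd_left h
  clear h
  have hdvd (n : ℤ) : n ∣ B' ↔ n ∣ B := by
    rcases hB' with rfl | rfl
    · rfl
    · exact dvd_neg
  have h16 := hdvd 16
  have h32 := hdvd 32
  have h64 := hdvd 64
  have h128 := hdvd 128
  have h256 := hdvd 256
  have h512 := hdvd 512
  have h1024 := hdvd 1024
  have h4096 := hdvd 4096
  have h8 := hdvd 8
  simp only [admissible_two_iff, KrausTwo, Nat.reduceMul, Int.reducePow] at hK hmin ⊢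
  by_cases h1 : ¬ 2 ∣ A ∧ ¬ 2 ∣ B
  · rw [if_pos h1]; clear r1 r2 r5 r7 hmin hK; omega
  rw [if_neg h1]
  obtain ⟨hA, hB⟩ : 16 ∣ A ∧ (B % 32 = 0 ∨ B % 32 = 8) := by
    rcases hK with hK | hK
    · have := r1 (by omega); omega
    · exact hK
  clear r1 h1 hK
  split_ifs with h2 h3
  · clear r2 r5 r7 hmin
    refine ⟨⟨by omega, by omega, by omega, by omega⟩, by omega⟩
  · clear r5 r7 hmin h2
    refine ⟨⟨by omega, by omega, by omega, by omega⟩, ?_⟩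
    rintro ⟨-, -, hD, hk⟩
    rcases hB with hB | hB
    · clear r2
      rcases hk with hk | ⟨hk, hk' | hk'⟩
      · omega
      · rcases h3 with h3 | (h3 | h3 | h3) | h3 <;> omega
      · rcases h3 with h3 | (h3 | h3 | h3) | h3 <;> omega
    · have := r2 hA (by omega) (by omega)
      omega
  · obtain ⟨hA', hB64⟩ : 64 ∣ A ∧ 64 ∣ B := by
      clear r2 r5 r7 hmin h2; omega
    clear r2 hB
    have r5 := r5 hA' hB64
    refine ⟨⟨by omega, by omega, ?_, ?_⟩, ?_⟩
    · clear r7 h2 h3 hmin; omega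
    · right
      clear r7 h2 hmin
      refine ⟨by omega, ?_⟩
      by_cases hB : 128 ∣ B
      · left; omega
      · right; have := r5.2 hB; omega
    · clear r5 h3
      rintro ⟨-, h6, hD, hk | ⟨h4, hk | hk⟩⟩
      · have := r7 hA (by omega) (by omega) (by omega)
        clear r7 hmin; omega
      · clear r7 h2; omega
      · clear r7 h2; omega

theorem natCast_le_vp_iff {p : ℕ} [Fact p.Prime] (n : ℕ) (A : ℤ) :
    ((n : ℤ) : WithTop ℤ) ≤ vp p (A : ℚ) ↔ (p : ℤ) ^ n ∣ A := by
  rw [padicValInt_dvd_iff, vp]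
  split_ifs with h
  · simpa using Or.inl (by exact_mod_cast h)
  · have h' : A ≠ 0 := by exact_mod_cast h
    rw [padicValRat.of_int, WithTop.coe_le_coe, Nat.cast_le]
    simp [h']

theorem le_vp_iff {p : ℕ} [Fact p.Prime] {n : ℕ} {A m : ℤ} {x : WithTop ℤ} (hm : m = (p : ℤ) ^ n)
    (hx : x = ((n : ℤ) : WithTop ℤ)) : x ≤ vp p (A : ℚ) ↔ m ∣ A := by
  rw [hx, hm, natCast_le_vp_iff]

theorem vp_eq_iff {p : ℕ} [Fact p.Prime] {n : ℕ} {A m m' : ℤ} {x : WithTop ℤ}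
    (hm : m = (p : ℤ) ^ n) (hm' : m' = (p : ℤ) ^ (n + 1)) (hx : x = ((n : ℤ) : WithTop ℤ)) :
    vp p (A : ℚ) = x ↔ m ∣ A ∧ ¬ m' ∣ A := by
  rw [← le_vp_iff hm hx, ← le_vp_iff hm' rfl, hx]
  generalize vp p (A : ℚ) = y
  cases y with
  | top => simp
  | coe y => norm_cast; push_cast; omega

theorem exists_disc_hasSignature_iff (E : WeierstrassCurve ℚ) (p : ℕ) (a b n : WithTop ℤ)
    (P : Prop) :
    (∃ c, n ≤ c ∧ HasSignature E p a b c ∧ P) ↔ vp p E.c₄ = a ∧ vp p E.c₆ = b ∧ n ≤ vp p E.Δ ∧ P :=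
  ⟨fun ⟨_, h, ⟨h4, h6, hD⟩, hP⟩ => ⟨h4, h6, hD ▸ h, hP⟩,
    fun ⟨h4, h6, hD, hP⟩ => ⟨_, hD, ⟨h4, h6, rfl⟩, hP⟩⟩

theorem exists_c₄_hasSignature_iff (E : WeierstrassCurve ℚ) (p : ℕ) (b c n : WithTop ℤ)
    (P : Prop) :
    (∃ a, n ≤ a ∧ HasSignature E p a b c ∧ P) ↔ n ≤ vp p E.c₄ ∧ vp p E.c₆ = b ∧ vp p E.Δ = c ∧ P :=
  ⟨fun ⟨_, h, ⟨h4, h6, hD⟩, hP⟩ => ⟨h4 ▸ h, h6, hD, hP⟩,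
    fun ⟨h4, h6, hD, hP⟩ => ⟨_, h4, ⟨rfl, h6, hD⟩, hP⟩⟩

theorem div_mul_modEq_iff {B m : ℤ} (hm : m ≠ 0) (h : m ∣ B) (x y : ℤ) :
    (B : ℚ) / m * x ≡ y [PMOD (4 : ℚ)] ↔ (B / m * x - y) % 4 = 0 := by
  have e : (B : ℚ) / m * x = ((B / m * x : ℤ) : ℚ) := by
    rw [Int.cast_mul, Int.cast_div h (by exact_mod_cast hm)]
  have e4 : (4 : ℚ) = ((4 : ℤ) : ℚ) := by norm_num
  rw [e, e4, AddCommGroup.intCast_modEq_intCast, AddCommGroup.modEq_iff_intModEq, Int.ModEq]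
  omega

theorem emod_four_iff_of_one {w : ℤ} (hw : w % 4 = 1) (x y : ℤ) :
    (x * w - y) % 4 = 0 ↔ (x - y) % 4 = 0 := by
  obtain ⟨q, rfl⟩ : ∃ q, w = 4 * q + 1 := ⟨w / 4, by omega⟩
  have : x * (4 * q + 1) = 4 * (x * q) + x := by ring
  rw [this]; omega

theorem emod_four_iff_of_three {w : ℤ} (hw : w % 4 = 3) (x y : ℤ) :
    (x * w - y) % 4 = 0 ↔ (x + y) % 4 = 0 := by
  obtain ⟨q, rfl⟩ : ∃ q, w = 4 * q - 1 := ⟨w / 4 + 1, by omega⟩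
  have : x * (4 * q - 1) = 4 * (x * q) - x := by ring
  rw [this]; omega

/-- `p ^ k` is the scaling factor at `p` leading from `(A, B, D)` to a minimal triple. -/
def IsScaling (p k : ℕ) (A B D : ℤ) : Prop :=
  Admissible p k A B D ∧ ¬ Admissible p (k + 1) A B D

theorem isScaling_smul {p : ℕ} (hp : p.Prime) {w : ℤ} (hw : ¬ (p : ℤ) ∣ w)
    (hw2 : p = 2 → w % 4 = 1) (k : ℕ) (A B D : ℤ) :
    IsScaling p k (w ^ 2 * A) (w ^ 3 * B) (w ^ 6 * D) ↔ IsScaling p k A B D := by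
  simp only [IsScaling, admissible_smul hp hw hw2]

theorem not_dvd_of_squarefree_mul {p : ℕ} (hp : p.Prime) {e : ℤ} (h : Squarefree ((p : ℤ) * e)) :
    ¬ (p : ℤ) ∣ e := by
  rintro ⟨f, rfl⟩
  exact (Nat.prime_iff_prime_int.mp hp).not_isUnit (h p ⟨f, by ring⟩)

theorem six_le_lam_iff (V : WeierstrassCurve ℤ) (p : ℕ) [Fact p.Prime] :
    6 ≤ lam (V.map (Int.castRingHom ℚ)) p ↔
      (p : ℤ) ^ 2 ∣ V.c₄ ∧ (p : ℤ) ^ 3 ∣ V.c₆ ∧ (p : ℤ) ^ 6 ∣ V.Δ := by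
  rw [lam, map_c₄_cast, map_c₆_cast, map_Δ_cast, le_min_iff, le_min_iff,
    ← natCast_le_vp_iff, ← natCast_le_vp_iff, ← natCast_le_vp_iff]
  have e (k n : ℕ) (hk : k ≠ 0) (x : WithTop ℤ) :
      ((k * n : ℕ) : ℤ) ≤ k • x ↔ ((n : ℤ) : WithTop ℤ) ≤ x := by
    cases x with
    | top =>
      obtain ⟨k, rfl⟩ := Nat.exists_eq_succ_of_ne_zero hk
      simp [succ_nsmul]
    | coe x =>
      rw [← WithTop.coe_nsmul, WithTop.coe_le_coe, WithTop.coe_le_coe, nsmul_eq_mul]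
      push_cast
      exact mul_le_mul_iff_of_pos_left (by exact_mod_cast Nat.pos_of_ne_zero hk)
  exact and_congr (e 3 2 (by norm_num) _) (and_congr (e 2 3 (by norm_num) _) Iff.rfl)

theorem exists_isScaling_odd {V : WeierstrassCurve ℤ} {p : ℕ} [hp : Fact p.Prime] (hp2 : p ≠ 2)
    (hmin : ¬ Admissible p 1 V.c₄ V.c₆ V.Δ) {d : ℤ} (hd : Squarefree d) :
    ∃ k, oddFactor (V.map (Int.castRingHom ℚ)) d p = (p : ℚ) ^ k ∧
      IsScaling p k ((4 * d) ^ 2 * V.c₄) ((4 * d) ^ 3 * V.c₆) ((4 * d) ^ 6 * V.Δ) := by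
  have hpp := Nat.prime_iff_prime_int.mp hp.out
  have hp4 : ¬ (p : ℤ) ∣ 4 := fun h => hp2 <| by
    have : p ∣ 2 ^ 2 := by exact_mod_cast h
    exact (Nat.prime_dvd_prime_iff_eq hp.out Nat.prime_two).mp (hp.out.dvd_of_dvd_pow this)
  rw [oddFactor]
  by_cases hpd : (p : ℤ) ∣ d
  · rw [if_pos hpd]
    obtain ⟨e, rfl⟩ := hpd
    have hw : ¬ (p : ℤ) ∣ 4 * e := by
      rw [hpp.dvd_mul, not_or]; exact ⟨hp4, not_dvd_of_squarefree_mul hp.out hd⟩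
    have key (k : ℕ) : IsScaling p k ((4 * (p * e)) ^ 2 * V.c₄) ((4 * (p * e)) ^ 3 * V.c₆)
        ((4 * (p * e)) ^ 6 * V.Δ) ↔
        IsScaling p k (p ^ 2 * V.c₄) (p ^ 3 * V.c₆) (p ^ 6 * V.Δ) := by
      rw [← isScaling_smul hp.out hw (fun h => absurd h hp2) k (p ^ 2 * V.c₄)]
      ring_nf
    simp only [key]
    have hp0 (n : ℕ) : (p : ℤ) ^ n ≠ 0 := pow_ne_zero _ hpp.ne_zero
    have hlam := six_le_lam_iff V p
    have hv5 : p = 3 → (vp p (V.map (Int.castRingHom ℚ)).c₆ = 5 ↔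
        243 ∣ V.c₆ ∧ ¬ 729 ∣ V.c₆) := by
      rintro rfl
      rw [map_c₆_cast]
      exact vp_eq_iff (n := 5) (by norm_num) (by norm_num) rfl
    have cancel (i j : ℕ) {x y : ℤ} (h : (p : ℤ) ^ i * x = (p : ℤ) ^ (i + j) * y) :
        x = (p : ℤ) ^ j * y :=
      mul_left_cancel₀ (hp0 i) (by rw [h, pow_add]; ring)
    split_ifs with h
    · refine ⟨0, by simp, ?_, ?_⟩
      · rw [admissible_zero]
        refine ⟨fun h2 => absurd h2 hp2, ?_⟩
        rintro rfl _
        exact ⟨V.c₆, by norm_num⟩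
      · rintro ⟨a, b, c, ha, hb, hc, hk⟩
        have ha := cancel 2 2 ha
        have hb := cancel 3 3 hb
        have hc := cancel 6 6 hc
        have := hlam.mpr ⟨⟨a, ha⟩, ⟨b, hb⟩, ⟨c, hc⟩⟩
        rcases h with h | ⟨h3, h5⟩
        · exact absurd this (not_le.mpr h)
        · have hk3 := hk.2 h3
          rw [hv5 h3] at h5
          subst h3
          unfold KrausThree at hk3
          norm_num at hb
          omega
    · rw [not_or, not_lt, hlam, not_and] at h
      obtain ⟨⟨⟨a, ha⟩, ⟨b, hb⟩, ⟨c, hc⟩⟩, h5⟩ := h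
      refine ⟨1, by simp, ⟨a, b, c, by rw [ha]; ring, by rw [hb]; ring, by rw [hc]; ring,
        fun h2 => absurd h2 hp2, fun h3 => ?_⟩, ?_⟩
      · have h5 := mt (hv5 h3).mpr (h5 h3)
        subst h3
        unfold KrausThree
        norm_num at hb
        omega
      · rintro ⟨a, b, c, ha, hb, hc, hk⟩
        have ha := cancel 2 6 ha
        have hb := cancel 3 9 hb
        have hc := cancel 6 18 hc
        refine hmin ⟨p ^ 2 * a, p ^ 3 * b, p ^ 6 * c, by rw [ha]; ring, by rw [hb]; ring,
          by rw [hc]; ring, fun h2 => absurd h2 hp2, ?_⟩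
        rintro rfl _
        exact ⟨b, by norm_num⟩
  · rw [if_neg hpd]
    have hw : ¬ (p : ℤ) ∣ 4 * d := by
      rw [hpp.dvd_mul, not_or]; exact ⟨hp4, hpd⟩
    refine ⟨0, by simp, ?_⟩
    rw [isScaling_smul hp.out hw (fun h => absurd h hp2)]
    exact ⟨(admissible_zero _ _ _ _).mpr (krausAt_curve p V), hmin⟩

theorem exists_isScaling_of_three_mod_four {V : WeierstrassCurve ℤ}
    (hmin : ¬ Admissible 2 1 V.c₄ V.c₆ V.Δ) {d : ℤ} (hd : d % 4 = 3) :
    ∃ k, 2 * twoFactorOfThreeModFour (V.map (Int.castRingHom ℚ)) d = 2 ^ k ∧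
      IsScaling 2 k ((4 * d) ^ 2 * V.c₄) ((4 * d) ^ 3 * V.c₆) ((4 * d) ^ 6 * V.Δ) := by
  have key (k : ℕ) : IsScaling 2 k ((4 * d) ^ 2 * V.c₄) ((4 * d) ^ 3 * V.c₆) ((4 * d) ^ 6 * V.Δ) ↔
      IsScaling 2 k (16 * V.c₄) (64 * -V.c₆) (4096 * V.Δ) := by
    rw [← isScaling_smul Nat.prime_two (w := -d) (by omega) (by omega) k (16 * V.c₄)]
    ring_nf
  have core := admissible_two_of_three_mod_four (three_two_relation V) (krausTwo_curve V) hmin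
  simp only [key]
  have c1 : ((∃ c, 0 ≤ c ∧ HasSignature (V.map (Int.castRingHom ℚ)) 2 0 0 c) ∨
      ∃ a, 4 ≤ a ∧ HasSignature (V.map (Int.castRingHom ℚ)) 2 a 3 0) ↔
      (¬ 2 ∣ V.c₄ ∧ ¬ 2 ∣ V.c₆) ∨ (16 ∣ V.c₄ ∧ (8 ∣ V.c₆ ∧ ¬ 16 ∣ V.c₆) ∧ ¬ 2 ∣ V.Δ) := by
    have h1 := exists_disc_hasSignature_iff (V.map (Int.castRingHom ℚ)) 2 0 0 0 True
    have h2 := exists_c₄_hasSignature_iff (V.map (Int.castRingHom ℚ)) 2 3 0 4 True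
    rw [map_c₄_cast, map_c₆_cast, map_Δ_cast] at h1 h2
    rw [vp_eq_iff (p := 2) (n := 0) (x := 0) (m := 1) (m' := 2) (by norm_num) (by norm_num) rfl,
      vp_eq_iff (p := 2) (n := 0) (x := 0) (m := 1) (m' := 2) (by norm_num) (by norm_num) rfl,
      le_vp_iff (p := 2) (n := 0) (x := 0) (m := 1) (by norm_num) rfl] at h1
    rw [le_vp_iff (p := 2) (n := 4) (x := 4) (m := 16) (by norm_num) rfl,
      vp_eq_iff (p := 2) (n := 3) (x := 3) (m := 8) (m' := 16) (by norm_num) (by norm_num) rfl,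
      vp_eq_iff (p := 2) (n := 0) (x := 0) (m := 1) (m' := 2) (by norm_num) (by norm_num) rfl] at h2
    simp only [and_true, one_dvd, true_and] at h1 h2
    rw [h1, h2]
  have c2 : ((∃ c, 12 ≤ c ∧ HasSignature (V.map (Int.castRingHom ℚ)) 2 4 6 c ∧
        (V.map (Int.castRingHom ℚ)).c₆ / 2 ^ 6 * d ≡ -1 [PMOD (4 : ℚ)]) ∨
      ∃ a, 8 ≤ a ∧ HasSignature (V.map (Int.castRingHom ℚ)) 2 a 9 12 ∧
        (V.map (Int.castRingHom ℚ)).c₆ / 2 ^ 9 * d ≡ 1 [PMOD (4 : ℚ)]) ↔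
      ((16 ∣ V.c₄ ∧ ¬ 32 ∣ V.c₄) ∧ (64 ∣ V.c₆ ∧ ¬ 128 ∣ V.c₆) ∧ 4096 ∣ V.Δ ∧
        V.c₆ / 64 % 4 = 1) ∨
      (256 ∣ V.c₄ ∧ (512 ∣ V.c₆ ∧ ¬ 1024 ∣ V.c₆) ∧ (4096 ∣ V.Δ ∧ ¬ 8192 ∣ V.Δ) ∧
        V.c₆ / 512 % 4 = 3) := by
    rw [exists_disc_hasSignature_iff, exists_c₄_hasSignature_iff,
      map_c₄_cast, map_c₆_cast, map_Δ_cast,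
      vp_eq_iff (p := 2) (n := 4) (x := 4) (m := 16) (m' := 32) (by norm_num) (by norm_num) rfl,
      vp_eq_iff (p := 2) (n := 6) (x := 6) (m := 64) (m' := 128) (by norm_num) (by norm_num) rfl,
      le_vp_iff (p := 2) (n := 12) (x := 12) (m := 4096) (by norm_num) rfl,
      le_vp_iff (p := 2) (n := 8) (x := 8) (m := 256) (by norm_num) rfl,
      vp_eq_iff (p := 2) (n := 9) (x := 9) (m := 512) (m' := 1024) (by norm_num) (by norm_num) rfl,
      vp_eq_iff (p := 2) (n := 12) (x := 12) (m := 4096) (m' := 8192) (by norm_num)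
        (by norm_num) rfl]
    refine or_congr (and_congr_right fun _ => and_congr_right fun h => and_congr_right fun _ => ?_)
      (and_congr_right fun _ => and_congr_right fun h => and_congr_right fun _ => ?_)
    · have := div_mul_modEq_iff (m := 64) (by norm_num) h.1 d (-1)
      rw [emod_four_iff_of_three hd] at this
      norm_num at this ⊢
      rw [this]; omega
    · have := div_mul_modEq_iff (m := 512) (by norm_num) h.1 d 1
      rw [emod_four_iff_of_three hd] at this
      norm_num at this ⊢
      rw [this]; omega
  rw [twoFactorOfThreeModFour]
  simp only [c1, c2]
  split_ifs at core ⊢ with h1 h2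
  · exact ⟨0, by norm_num, core⟩
  · exact ⟨2, by norm_num, core⟩
  · exact ⟨1, by norm_num, core⟩

theorem exists_isScaling_of_two_mod_four {V : WeierstrassCurve ℤ}
    (hmin : ¬ Admissible 2 1 V.c₄ V.c₆ V.Δ) {d : ℤ} (hd : d % 4 = 2) :
    ∃ k, 2 * twoFactorOfTwoModFour (V.map (Int.castRingHom ℚ)) d = 2 ^ k ∧
      IsScaling 2 k ((4 * d) ^ 2 * V.c₄) ((4 * d) ^ 3 * V.c₆) ((4 * d) ^ 6 * V.Δ) := by
  obtain ⟨w, rfl⟩ : ∃ w, d = 2 * w := ⟨d / 2, by omega⟩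
  obtain ⟨B', hB', key, hmod⟩ : ∃ B', (B' = V.c₆ ∨ B' = -V.c₆) ∧
      (∀ k : ℕ, IsScaling 2 k ((4 * (2 * w)) ^ 2 * V.c₄) ((4 * (2 * w)) ^ 3 * V.c₆)
        ((4 * (2 * w)) ^ 6 * V.Δ) ↔ IsScaling 2 k (64 * V.c₄) (512 * B') (262144 * V.Δ)) ∧
      ∀ m : ℤ, m ≠ 0 → m ∣ V.c₆ →
        ((V.c₆ : ℚ) / m * w ≡ -1 [PMOD (4 : ℚ)] ↔ B' / m % 4 = 3) := by
    rcases (by omega : w % 4 = 1 ∨ w % 4 = 3) with hw | hw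
    · refine ⟨V.c₆, Or.inl rfl, fun k => ?_, fun m hm hdvd => ?_⟩
      · rw [← isScaling_smul Nat.prime_two (w := w) (by omega) (by omega) k (64 * V.c₄)]
        ring_nf
      · have := div_mul_modEq_iff hm hdvd w (-1)
        rw [emod_four_iff_of_one hw] at this
        push_cast at this
        rw [this]; omega
    · refine ⟨-V.c₆, Or.inr rfl, fun k => ?_, fun m hm hdvd => ?_⟩
      · rw [← isScaling_smul Nat.prime_two (w := -w) (by omega) (by omega) k (64 * V.c₄)]
        ring_nf
      · have := div_mul_modEq_iff hm hdvd w (-1)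
        rw [emod_four_iff_of_three hw] at this
        push_cast at this
        rw [this, Int.neg_ediv_of_dvd hdvd]; omega
  have core := admissible_two_of_two_mod_four (three_two_relation V) (krausTwo_curve V) hmin hB'
  simp only [key]
  have hw2 : ((2 * w : ℤ) : ℚ) / 2 = w := by push_cast; ring
  have c1 : (∃ c, 0 ≤ c ∧ HasSignature (V.map (Int.castRingHom ℚ)) 2 0 0 c) ↔
      ¬ 2 ∣ V.c₄ ∧ ¬ 2 ∣ V.c₆ := by
    have h1 := exists_disc_hasSignature_iff (V.map (Int.castRingHom ℚ)) 2 0 0 0 True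
    rw [map_c₄_cast, map_c₆_cast, map_Δ_cast,
      vp_eq_iff (p := 2) (n := 0) (x := 0) (m := 1) (m' := 2) (by norm_num) (by norm_num) rfl,
      vp_eq_iff (p := 2) (n := 0) (x := 0) (m := 1) (m' := 2) (by norm_num) (by norm_num) rfl,
      le_vp_iff (p := 2) (n := 0) (x := 0) (m := 1) (by norm_num) rfl] at h1
    simpa only [and_true, one_dvd, true_and] using h1
  have c2 : (∃ c, 18 ≤ c ∧ HasSignature (V.map (Int.castRingHom ℚ)) 2 6 9 c ∧
        (V.map (Int.castRingHom ℚ)).c₆ / 2 ^ 9 * (w : ℚ) ≡ -1 [PMOD (4 : ℚ)]) ↔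
      (64 ∣ V.c₄ ∧ ¬ 128 ∣ V.c₄) ∧ (512 ∣ V.c₆ ∧ ¬ 1024 ∣ V.c₆) ∧ 262144 ∣ V.Δ ∧
        B' / 512 % 4 = 3 := by
    rw [exists_disc_hasSignature_iff, map_c₄_cast, map_c₆_cast, map_Δ_cast,
      vp_eq_iff (p := 2) (n := 6) (x := 6) (m := 64) (m' := 128) (by norm_num) (by norm_num) rfl,
      vp_eq_iff (p := 2) (n := 9) (x := 9) (m := 512) (m' := 1024) (by norm_num) (by norm_num) rfl,
      le_vp_iff (p := 2) (n := 18) (x := 18) (m := 262144) (by norm_num) rfl]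
    refine and_congr_right fun _ => and_congr_right fun h => and_congr_right fun _ => ?_
    rw [← hmod 512 (by norm_num) h.1]
    norm_num
  have c3 : ((vp 2 (V.map (Int.castRingHom ℚ)).c₄ = 4 ∨ vp 2 (V.map (Int.castRingHom ℚ)).c₄ = 5) ∨
      (vp 2 (V.map (Int.castRingHom ℚ)).c₆ = 3 ∨ vp 2 (V.map (Int.castRingHom ℚ)).c₆ = 5 ∨
        vp 2 (V.map (Int.castRingHom ℚ)).c₆ = 7) ∨
      ∃ a, 6 ≤ a ∧ HasSignature (V.map (Int.castRingHom ℚ)) 2 a 6 6 ∧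
        (V.map (Int.castRingHom ℚ)).c₆ / 2 ^ 6 * (w : ℚ) ≡ -1 [PMOD (4 : ℚ)]) ↔
      ((16 ∣ V.c₄ ∧ ¬ 32 ∣ V.c₄) ∨ (32 ∣ V.c₄ ∧ ¬ 64 ∣ V.c₄)) ∨
        ((8 ∣ V.c₆ ∧ ¬ 16 ∣ V.c₆) ∨ (32 ∣ V.c₆ ∧ ¬ 64 ∣ V.c₆) ∨ (128 ∣ V.c₆ ∧ ¬ 256 ∣ V.c₆)) ∨
        (64 ∣ V.c₄ ∧ (64 ∣ V.c₆ ∧ ¬ 128 ∣ V.c₆) ∧ (64 ∣ V.Δ ∧ ¬ 128 ∣ V.Δ) ∧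
          B' / 64 % 4 = 3) := by
    rw [exists_c₄_hasSignature_iff, map_c₄_cast, map_c₆_cast, map_Δ_cast,
      vp_eq_iff (p := 2) (n := 4) (x := 4) (m := 16) (m' := 32) (by norm_num) (by norm_num) rfl,
      vp_eq_iff (p := 2) (n := 5) (x := 5) (m := 32) (m' := 64) (by norm_num) (by norm_num) rfl,
      vp_eq_iff (p := 2) (n := 3) (x := 3) (m := 8) (m' := 16) (by norm_num) (by norm_num) rfl,
      vp_eq_iff (p := 2) (n := 5) (x := 5) (m := 32) (m' := 64) (by norm_num) (by norm_num) rfl,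
      vp_eq_iff (p := 2) (n := 7) (x := 7) (m := 128) (m' := 256) (by norm_num) (by norm_num) rfl,
      le_vp_iff (p := 2) (n := 6) (x := 6) (m := 64) (by norm_num) rfl,
      vp_eq_iff (p := 2) (n := 6) (x := 6) (m := 64) (m' := 128) (by norm_num) (by norm_num) rfl,
      vp_eq_iff (p := 2) (n := 6) (x := 6) (m := 64) (m' := 128) (by norm_num) (by norm_num) rfl]
    refine or_congr_right (or_congr_right
      (and_congr_right fun _ => and_congr_right fun h => and_congr_right fun _ => ?_))
    rw [← hmod 64 (by norm_num) h.1]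
    norm_num
  rw [twoFactorOfTwoModFour]
  simp only [hw2, c1, c2, c3]
  split_ifs at core ⊢ with h1 h2 h3
  · exact ⟨0, by norm_num, core⟩
  · exact ⟨3, by norm_num, core⟩
  · exact ⟨1, by norm_num, core⟩
  · exact ⟨2, by norm_num, core⟩

/-- Twice the proposed scaling factor at `2` is the one of the twist scaled by `1 / 2`. -/
theorem exists_isScaling {V : WeierstrassCurve ℤ} {p : ℕ} [hp : Fact p.Prime]
    (hmin : ¬ Admissible p 1 V.c₄ V.c₆ V.Δ) {d : ℤ} (hd : Squarefree d) :
    ∃ k, (if p = 2 then 2 else 1) * localFactor (V.map (Int.castRingHom ℚ)) d p = (p : ℚ) ^ k ∧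
      IsScaling p k ((4 * d) ^ 2 * V.c₄) ((4 * d) ^ 3 * V.c₆) ((4 * d) ^ 6 * V.Δ) := by
  rw [localFactor]
  split_ifs with hp2 h1 h3
  · subst hp2
    have hd1 : d % 4 = 1 := h1
    refine ⟨1, by norm_num, ?_⟩
    have e (k : ℕ) : Admissible 2 (1 + k) ((4 * d) ^ 2 * V.c₄) ((4 * d) ^ 3 * V.c₆)
        ((4 * d) ^ 6 * V.Δ) ↔ Admissible 2 k V.c₄ V.c₆ V.Δ := by
      rw [← admissible_add Nat.prime_two 1 k,
        ← admissible_smul Nat.prime_two (w := d) (by omega) (fun _ => hd1) (1 + k)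
          (((2 : ℕ) ^ 1 : ℤ) ^ 4 * V.c₄)]
      push_cast
      ring_nf
    exact ⟨(e 0).mpr ((admissible_zero _ _ _ _).mpr (krausAt_curve 2 V)), mt (e 1).mp hmin⟩
  · subst hp2
    exact_mod_cast exists_isScaling_of_three_mod_four hmin h3
  · subst hp2
    have hd0 : d % 4 ≠ 0 := fun h => by
      have := hd 2 (by omega)
      exact absurd (Int.isUnit_iff.mp this) (by norm_num)
    have h1' : d % 4 ≠ 1 := h1
    have h3' : d % 4 ≠ 3 := h3
    exact_mod_cast exists_isScaling_of_two_mod_four hmin (by omega)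
  · rw [one_mul]
    exact exists_isScaling_odd hp2 hmin hd

theorem isScaling_zero_of_isScaling {p : ℕ} (hp : p.Prime) {k : ℕ} {M : ℤ} (hM : ¬ (p : ℤ) ∣ M)
    {A B D : ℤ} (h : IsScaling p k ((p ^ k * M) ^ 4 * A) ((p ^ k * M) ^ 6 * B)
      ((p ^ k * M) ^ 12 * D)) : KrausAt p A B ∧ ¬ Admissible p 1 A B D := by
  have e (j : ℕ) : Admissible p (k + j) ((p ^ k * M) ^ 4 * A) ((p ^ k * M) ^ 6 * B)
      ((p ^ k * M) ^ 12 * D) ↔ Admissible p j A B D := by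
    rw [← admissible_scale hp hM j, ← admissible_add hp k j]
    simp only [mul_pow, mul_assoc]
  exact ⟨(admissible_zero _ _ _ _).mp ((e 0).mp h.1), fun h' => h.2 ((e 1).mpr h')⟩

theorem pow_dvd_of_forall_prime {N : ℕ} {A : ℤ} {n : ℕ}
    (h : ∀ p : ℕ, p.Prime → ∃ (k : ℕ) (M : ℤ), (N : ℤ) = p ^ k * M ∧ ¬ (p : ℤ) ∣ M ∧
      (p : ℤ) ^ (n * k) ∣ A) : (N : ℤ) ^ n ∣ A := by
  rw [← Int.natCast_pow, Int.natCast_dvd, Nat.dvd_iff_prime_pow_dvd_dvd]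
  intro p j hp hj
  obtain ⟨k, M, hN, hM, hA⟩ := h p hp
  rw [← Int.natCast_dvd, Int.natCast_pow]
  refine dvd_trans ?_ hA
  have hj' : (p : ℤ) ^ j ∣ (p : ℤ) ^ (n * k) * M ^ n := by
    have : ((p ^ j : ℕ) : ℤ) ∣ ((N ^ n : ℕ) : ℤ) := Int.natCast_dvd_natCast.mpr hj
    rw [Int.natCast_pow, Int.natCast_pow, hN, mul_pow, ← pow_mul, mul_comm k n] at this
    exact this
  exact IsCoprime.dvd_of_dvd_mul_right
    (((Nat.prime_iff_prime_int.mp hp).coprime_iff_not_dvd.mpr hM).pow) hj'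

theorem twist_c₄ (E : WeierstrassCurve ℚ) (d : ℤ) : (twist E d).c₄ = d ^ 2 * E.c₄ := by
  simp only [twist, WeierstrassCurve.c₄, WeierstrassCurve.b₂, WeierstrassCurve.b₄]
  ring

theorem twist_c₆ (E : WeierstrassCurve ℚ) (d : ℤ) : (twist E d).c₆ = d ^ 3 * E.c₆ := by
  simp only [twist, WeierstrassCurve.c₆, WeierstrassCurve.b₂, WeierstrassCurve.b₄,
    WeierstrassCurve.b₆]
  ring

/-- A triple of invariants with a global scaling factor `N` comes from a global minimal equation
after division by the appropriate powers of `N`. -/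
theorem exists_isGlobalMinimal {A B D : ℤ} (hD : D ≠ 0) (h : A ^ 3 - B ^ 2 = 1728 * D) {N : ℕ}
    (hN : ∀ p : ℕ, p.Prime → ∃ (k : ℕ) (M : ℤ), (N : ℤ) = p ^ k * M ∧ ¬ (p : ℤ) ∣ M ∧
      IsScaling p k A B D) :
    ∃ V : WeierstrassCurve ℤ, A = (N : ℤ) ^ 4 * V.c₄ ∧ B = (N : ℤ) ^ 6 * V.c₆ ∧
      IsGlobalMinimal (V.map (Int.castRingHom ℚ)) := by
  obtain ⟨a, rfl⟩ : (N : ℤ) ^ 4 ∣ A := pow_dvd_of_forall_prime fun p hp => by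
    obtain ⟨k, M, h1, h2, ⟨⟨a, b, c, h3, -⟩, -⟩⟩ := hN p hp
    exact ⟨k, M, h1, h2, a, h3⟩
  obtain ⟨b, rfl⟩ : (N : ℤ) ^ 6 ∣ B := pow_dvd_of_forall_prime fun p hp => by
    obtain ⟨k, M, h1, h2, ⟨⟨a, b, c, -, h3, -⟩, -⟩⟩ := hN p hp
    exact ⟨k, M, h1, h2, b, h3⟩
  obtain ⟨c, rfl⟩ : (N : ℤ) ^ 12 ∣ D := pow_dvd_of_forall_prime fun p hp => by
    obtain ⟨k, M, h1, h2, ⟨⟨a, b, c, -, -, h3, -⟩, -⟩⟩ := hN p hp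
    exact ⟨k, M, h1, h2, c, h3⟩
  have hN0 : (N : ℤ) ^ 12 ≠ 0 := left_ne_zero_of_mul hD
  have hrel : a ^ 3 - b ^ 2 = 1728 * c := mul_left_cancel₀ hN0 (by linear_combination h)
  have hloc (p : ℕ) (hp : p.Prime) : KrausAt p a b ∧ ¬ Admissible p 1 a b c := by
    obtain ⟨k, M, h1, h2, h3⟩ := hN p hp
    rw [h1] at h3
    exact isScaling_zero_of_isScaling hp h2 h3
  obtain ⟨V, rfl, rfl⟩ := exists_curve_of_kraus hrel ((hloc 2 Nat.prime_two).1.1 rfl)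
    ((hloc 3 Nat.prime_three).1.2 rfl)
  have hc : c = V.Δ :=
    mul_left_cancel₀ (by norm_num : (1728 : ℤ) ≠ 0) (hrel.symm.trans (three_two_relation V))
  subst hc
  exact ⟨V, rfl, rfl, ⟨V, rfl⟩, fun p hp => isMinimal_of_not_admissible_one (hloc p hp.out).2⟩

/-- A finite product of prime powers over `ℚ`, together with its factorization at every prime. -/
theorem exists_nat_eq_finprod {f : Nat.Primes → ℚ} (hf : (Function.mulSupport f).Finite)
    {k : Nat.Primes → ℕ}
    (hk : ∀ p : Nat.Primes, (if (p : ℕ) = 2 then 2 else 1) * f p = ((p : ℕ) : ℚ) ^ k p) :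
    ∃ N : ℕ, (N : ℚ) = 2 * ∏ᶠ p, f p ∧
      ∀ p : Nat.Primes, ∃ M : ℤ, (N : ℤ) = (p : ℕ) ^ k p * M ∧ ¬ ((p : ℕ) : ℤ) ∣ M := by
  classical
  obtain ⟨two, htwo⟩ : ∃ two : Nat.Primes, two = ⟨2, Nat.prime_two⟩ := ⟨_, rfl⟩
  have htwo' (p : Nat.Primes) : (p : ℕ) = 2 ↔ p = two := by
    rw [htwo]; exact ⟨fun h => Subtype.ext h, congrArg Subtype.val⟩
  obtain ⟨S, hS⟩ : ∃ S, S = insert two hf.toFinset := ⟨_, rfl⟩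
  have h2S : two ∈ S := hS ▸ Finset.mem_insert_self _ _
  have hout (p : Nat.Primes) (hp : p ∉ S) : k p = 0 := by
    rw [hS, Finset.mem_insert, not_or, Set.Finite.mem_toFinset, Function.notMem_mulSupport] at hp
    have := hk p
    rw [if_neg (mt (htwo' p).mp hp.1), hp.2, mul_one] at this
    by_contra h0
    exact absurd this (ne_of_lt (one_lt_pow₀ (by exact_mod_cast p.2.one_lt) h0))
  refine ⟨∏ p ∈ S, (p : ℕ) ^ k p, ?_, fun p => ?_⟩
  · rw [finprod_eq_prod_of_mulSupport_subset f (s := S) (by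
      rw [hS]; intro x hx; simp [Function.mem_mulSupport.mp hx])]
    push_cast
    rw [← Finset.prod_congr rfl (fun p _ => hk p), Finset.prod_mul_distrib]
    congr 1
    simp only [htwo']
    rw [Finset.prod_ite_eq' S two, if_pos h2S]
  · refine ⟨((∏ q ∈ S.erase p, (q : ℕ) ^ k q : ℕ) : ℤ), ?_, ?_⟩
    · by_cases hp : p ∈ S
      · rw [← Finset.mul_prod_erase S _ hp]; push_cast; rfl
      · rw [hout p hp, Finset.erase_eq_of_notMem hp]; simp
    · rw [Int.natCast_dvd_natCast, Prime.dvd_finsetProd_iff p.2.prime]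
      rintro ⟨q, hq, hd⟩
      have := (Nat.prime_dvd_prime_iff_eq p.2 q.2).mp (p.2.dvd_of_dvd_pow hd)
      exact (Finset.ne_of_mem_erase hq) (Subtype.ext this.symm)

end QuadraticTwist

theorem mainTheorem2 (E : WeierstrassCurve ℚ) [E.IsElliptic]
    (hE : QuadraticTwist.IsGlobalMinimal E) (d : ℤ) (hd : Squarefree d) :
    ∃ (u : ℚˣ) (r s t : ℚ), (u : ℚ) = QuadraticTwist.uTilde E d ∧
      QuadraticTwist.IsGlobalMinimal
        ((⟨u, r, s, t⟩ : WeierstrassCurve.VariableChange ℚ) • QuadraticTwist.twist E d) := by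
  obtain ⟨⟨V, hV⟩, hmin⟩ := hE
  have hV' : E = V.map (Int.castRingHom ℚ) := hV
  have hΔE : E.Δ ≠ 0 := E.isUnit_Δ.ne_zero
  subst hV'
  have hΔ : V.Δ ≠ 0 := by
    rw [QuadraticTwist.map_Δ_cast] at hΔE
    exact_mod_cast hΔE
  have hloc (p : Nat.Primes) := by
    have : Fact (p : ℕ).Prime := ⟨p.2⟩
    exact QuadraticTwist.exists_isScaling
      (QuadraticTwist.not_admissible_one_of_isMinimal hΔ (hmin p)) hd
  choose k hk hscal using hloc
  obtain ⟨N, hN, hNp⟩ := QuadraticTwist.exists_nat_eq_finprod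
    (QuadraticTwist.finite_mulSupport_localFactor _ hd.ne_zero) hk
  have hd0 : (4 * d) ^ 6 * V.Δ ≠ 0 :=
    mul_ne_zero (pow_ne_zero _ (mul_ne_zero (by norm_num) hd.ne_zero)) hΔ
  obtain ⟨W, h4, h6, hW⟩ := QuadraticTwist.exists_isGlobalMinimal
    (A := (4 * d) ^ 2 * V.c₄) (B := (4 * d) ^ 3 * V.c₆) hd0
    (by linear_combination (4 * d) ^ 6 * QuadraticTwist.three_two_relation V)
    (N := N) (fun p hp => by
      obtain ⟨M, h1, h2⟩ := hNp ⟨p, hp⟩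
      exact ⟨k ⟨p, hp⟩, M, h1, h2, hscal ⟨p, hp⟩⟩)
  have hN0 : (N : ℚ) ≠ 0 := by
    intro h0
    have h0' : N = 0 := by exact_mod_cast h0
    obtain ⟨M, h1, h2⟩ := hNp ⟨2, Nat.prime_two⟩
    rw [h0', Nat.cast_zero, eq_comm, mul_eq_zero] at h1
    rcases h1 with h1 | rfl
    · exact absurd h1 (pow_ne_zero _ (by norm_num))
    · exact h2 (dvd_zero _)
  have hN' : (N : ℚ) = 2 * QuadraticTwist.uTilde (V.map (Int.castRingHom ℚ)) d := hN
  have hu0 : QuadraticTwist.uTilde (V.map (Int.castRingHom ℚ)) d ≠ 0 := by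
    intro h0; rw [h0, mul_zero] at hN'; exact hN0 hN'
  have h4' : ((4 * d) ^ 2 * V.c₄ : ℚ) = (N : ℚ) ^ 4 * W.c₄ := by exact_mod_cast h4
  have h6' : ((4 * d) ^ 3 * V.c₆ : ℚ) = (N : ℚ) ^ 6 * W.c₆ := by exact_mod_cast h6
  rw [hN'] at h4' h6'
  obtain ⟨r, s, t, h⟩ := QuadraticTwist.exists_variableChange
    (QuadraticTwist.twist (V.map (Int.castRingHom ℚ)) d) (W.map (Int.castRingHom ℚ))
    (Units.mk0 _ hu0)
    (by rw [QuadraticTwist.twist_c₄, QuadraticTwist.map_c₄_cast, QuadraticTwist.map_c₄_cast,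
          Units.val_mk0]
        linear_combination h4' / 16)
    (by rw [QuadraticTwist.twist_c₆, QuadraticTwist.map_c₆_cast, QuadraticTwist.map_c₆_cast,
          Units.val_mk0]
        linear_combination h6' / 64)
  exact ⟨Units.mk0 _ hu0, r, s, t, rfl, h ▸ hW⟩
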